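/- Let $n\ge 0$, let $X,Y\subset\mathbb{R}^n$ be compact sets with non-empty interior, and let $c:X\times Y\to\mathbb{R}$. Assume: - ($C^2$) the gradients $D_xc(x,y)$ and $D_yc(x,y)$ exist on $X\times Y$, the mixed Hessians $D^2_{xy}c=D_y(D_xc)$ and $D^2_{yx}c=D_x(D_yc)$ exist and are continuous on $X\times Y$, and $D^2_{xy}c=(D^2_{yx}c)^T$ (derivatives are taken within $X$ and within $Y$, so they are one-sided at boundary points; nothing is assumed on $D^2_{xx}c$ and $D^2_{yy}c$); - (bi-twist) $-D_xc(x,\cdot):Y\to\mathbb{R}^n$ is injective for every $x\in X$, and $-D_yc(\cdot,y):X\to\mathbb{R}^n$ is injective for every $y\in Y$; - (non-degeneracy) $-D^2_{xy}c(x,y)$ is invertible for every $(x,y)\in X\times Y$; - ($c$-convexity of the domains) $-D_yc(X,y)$ is convex for every $y\in Y$, and $-D_xc(x,Y)$ is convex for every $x\in X$. For $y\in Y$ and $x_0,x_1\in X$, the $c$-segment $[x_0,x_1]_y$ is the set of $x\in X$ such that $-D_yc(x,y)=t\,(-D_yc(x_1,y))+(1-t)(-D_yc(x_0,y))$ for some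 $t\in[0,1]$. The cost $c$ satisfies Loeper's property if for all $x_0,x_1\in X$, $y_0,y\in Y$ and $x\in[x_0,x_1]_{y_0}$, $$-c(x,y)+c(x,y_0)\le\max\{-c(x_i,y)+c(x_i,y_0): i=0,1\}.$$ A function $\phi:X\to\mathbb{R}$ is $c$-convex if there is $\psi:Y\to\mathbb{R}\cup\{-\infty\}$, not identically $-\infty$, with $\phi(x)=\sup_{y\in Y}\{-c(x,y)+\psi(y)\}$ for all $x\in X$. For $X_i=(x_i,u_i)\in X\times\mathbb{R}$, $i=0,1$, the $c$-chord between $X_0$ and $X_1$ is $$F_{X_0X_1}(x)=\sup\{-c(x,y)+h : y\in Y,\ h\in\mathbb{R},\ -c(x_i,y)+h\le u_i \text{ for } i=0,1\},\qquad x\in X.$$ A function $\phi:X\to\mathbb{R}$ is alternative $c$-convex if $\phi(x)\le F_{X_0X_1}(x)$ for all $x_0,x_1,x\in X$, where $X_i=(x_i,\phi(x_i))$. Then: 1. If $c$ satisfies Loeper's property, then a function $\phi:X\to\mathbb{R}$ is $c$-convex if and only if it is alternative $c$-convex. 2. If $c$ does not satisfy Loeper's property, then there exists an alternative $c$-convex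 function $\phi:X\to\mathbb{R}$ that is not $c$-convex. -/

import Mathlib

noncomputable section

namespace OTCost

/-- Euclidean space of dimension `n`. -/
abbrev E (n : ℕ) : Type := EuclideanSpace ℝ (Fin n)

variable {n : ℕ}

/-! A cost function `c` is given as a total function `E n → E n → ℝ`, but every notion below
uses only its values on `X × Y`. Derivatives are taken within `X` and within `Y`, so that they
are one-sided at boundary points. -/

/-- The gradient `D_x c (x, y)`. -/
def gradX (X : Set (E n)) (c : E n → E n → ℝ) (x y : E n) : E n :=
  gradientWithin (fun x' => c x' y) X x

/-- The gradient `D_y c (x, y)`. -/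
def gradY (Y : Set (E n)) (c : E n → E n → ℝ) (x y : E n) : E n :=
  gradientWithin (fun y' => c x y') Y y

/-- The mixed Hessian `D²_{xy} c (x, y)`, the matrix with entries `∂²c / ∂xᵢ ∂yⱼ` as a linear map:
the derivative in `y` of the gradient in `x`. -/
def hessXY (X Y : Set (E n)) (c : E n → E n → ℝ) (x y : E n) : E n →L[ℝ] E n :=
  fderivWithin ℝ (fun y' => gradX X c x y') Y y

/-- The mixed Hessian `D²_{yx} c (x, y)`: the derivative in `x` of the gradient in `y`. -/
def hessYX (X Y : Set (E n)) (c : E n → E n → ℝ) (x y : E n) : E n →L[ℝ] E n :=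
  fderivWithin ℝ (fun x' => gradY Y c x' y) X x

/-- `c` is `C²` on `X × Y` in the sense that both mixed Hessians exist, are continuous, and are
transposes of one another (nothing is required of `D²_{xx} c` and `D²_{yy} c`). -/
structure IsC2 (X Y : Set (E n)) (c : E n → E n → ℝ) : Prop where
  diffX : ∀ x ∈ X, ∀ y ∈ Y, DifferentiableWithinAt ℝ (fun x' => c x' y) X x
  diffY : ∀ x ∈ X, ∀ y ∈ Y, DifferentiableWithinAt ℝ (fun y' => c x y') Y y
  diffXY : ∀ x ∈ X, ∀ y ∈ Y, DifferentiableWithinAt ℝ (fun y' => gradX X c x y') Y y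
  diffYX : ∀ x ∈ X, ∀ y ∈ Y, DifferentiableWithinAt ℝ (fun x' => gradY Y c x' y) X x
  contXY : ContinuousOn (fun p : E n × E n => hessXY X Y c p.1 p.2) (X ×ˢ Y)
  contYX : ContinuousOn (fun p : E n × E n => hessYX X Y c p.1 p.2) (X ×ˢ Y)
  symm : ∀ x ∈ X, ∀ y ∈ Y,
    hessXY X Y c x y = ContinuousLinearMap.adjoint (hessYX X Y c x y)

/-- Twist and twist* conditions: `-D_x c (x, ·)` is injective on `Y` for every `x ∈ X`, and
`-D_y c (·, y)` is injective on `X` for every `y ∈ Y`. -/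
def BiTwisted (X Y : Set (E n)) (c : E n → E n → ℝ) : Prop :=
  (∀ x ∈ X, Set.InjOn (fun y => -gradX X c x y) Y) ∧
    (∀ y ∈ Y, Set.InjOn (fun x => -gradY Y c x y) X)

/-- The mixed Hessian is invertible at every point of `X × Y`. -/
def NonDegenerate (X Y : Set (E n)) (c : E n → E n → ℝ) : Prop :=
  ∀ x ∈ X, ∀ y ∈ Y, (-hessXY X Y c x y).IsInvertible

/-- `A ⊆ X` is `c`-convex with respect to `Y`: `[A]_y = -D_y c (A, y)` is convex for all `y ∈ Y`. -/
def CConvexSetX (Y : Set (E n)) (c : E n → E n → ℝ) (A : Set (E n)) : Prop :=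
  ∀ y ∈ Y, Convex ℝ ((fun x => -gradY Y c x y) '' A)

/-- `B ⊆ Y` is `c`-convex with respect to `X`: `[B]_x = -D_x c (x, B)` is convex for all `x ∈ X`. -/
def CConvexSetY (X : Set (E n)) (c : E n → E n → ℝ) (B : Set (E n)) : Prop :=
  ∀ x ∈ X, Convex ℝ ((fun y => -gradX X c x y) '' B)

/-- The `c`-segment with respect to `y` from `x₀` to `x₁`: the points of `X` that `-D_y c (·, y)`
maps into the Euclidean segment between `-D_y c (x₀, y)` and `-D_y c (x₁, y)`, that is, the image
of that segment under the inverse (the `c`-exponential map) of `-D_y c (·, y)` on `X`. -/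
def cSegment (X Y : Set (E n)) (c : E n → E n → ℝ) (y x₀ x₁ : E n) : Set (E n) :=
  {x ∈ X | -gradY Y c x y ∈ segment ℝ (-gradY Y c x₀ y) (-gradY Y c x₁ y)}

/-- Loeper's property. -/
def Loeper (X Y : Set (E n)) (c : E n → E n → ℝ) : Prop :=
  ∀ x₀ ∈ X, ∀ x₁ ∈ X, ∀ y₀ ∈ Y, ∀ y ∈ Y, ∀ x ∈ cSegment X Y c y₀ x₀ x₁,
    -c x y + c x y₀ ≤ max (-c x₀ y + c x₀ y₀) (-c x₁ y + c x₁ y₀)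

/-- `φ : X → ℝ` is `c`-convex: `φ x = sup_{y ∈ Y} (-c (x, y) + ψ y)` for some
`ψ : Y → ℝ ∪ {-∞}` that is not identically `-∞`. -/
def IsCConvex (X Y : Set (E n)) (c : E n → E n → ℝ) (φ : X → ℝ) : Prop :=
  ∃ ψ : Y → EReal, (∀ y, ψ y ≠ ⊤) ∧ (∃ y, ψ y ≠ ⊥) ∧
    ∀ x : X, (φ x : EReal) = ⨆ y : Y, (((-c x y : ℝ) : EReal) + ψ y)

/-- The `c`-chord between `(x₀, u₀)` and `(x₁, u₁)`, evaluated at `x`: the supremum, taken in the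
extended reals, of the values `-c (x, y) + h` of the `c`-affine functions that lie below `uᵢ`
at `xᵢ`. -/
def cChord (Y : Set (E n)) (c : E n → E n → ℝ) (x₀ : E n) (u₀ : ℝ) (x₁ : E n) (u₁ : ℝ)
    (x : E n) : EReal :=
  sSup {z : EReal | ∃ y ∈ Y, ∃ h : ℝ,
    -c x₀ y + h ≤ u₀ ∧ -c x₁ y + h ≤ u₁ ∧ z = ((-c x y + h : ℝ) : EReal)}

/-- `φ : X → ℝ` is alternative `c`-convex: it lies below every `c`-chord between two points of
its graph. -/
def IsAltCConvex (X Y : Set (E n)) (c : E n → E n → ℝ) (φ : X → ℝ) : Prop :=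
  ∀ x₀ x₁ x : X, (φ x : EReal) ≤ cChord Y c x₀ (φ x₀) x₁ (φ x₁) x

end OTCost

end

/-!
# `c`-convexity and alternative `c`-convexity

Throughout, a `c`-affine function is a function `-c (·, y) + h`. By compactness of `Y`, a function
`φ` is `c`-convex when at every point some `c`-affine function touches it from below on all of `X`,
and alternative `c`-convex when for every point `x` and every pair of points some `c`-affine
function agrees with `φ` at `x` and lies below `φ` at the pair (`isCConvex_iff`,
`isAltCConvex_iff`). So `c`-convexity always implies its alternative version.

All arguments take place in the dual coordinates `p = -D_x c (x, y)` at a point `x`, in which `Y`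
is a convex body `coordSet` and the inverse `cExp` is continuously differentiable up to the
boundary; the same holds with the roles of `X` and `Y` exchanged (`Admissible.swap`). Integrating
the mixed Hessian along segments in these coordinates shows that `c`, and the increments of its
gradients, are jointly continuous, although `D_x c` need not be continuous in `x`.

*Loeper's property makes supports global* (`Loeper.exists_support`). Let `φ` be alternative
`c`-convex. Maximize over `y` the function `m y = min_z (φ z + c (z, y) - c (x, y))`, and suppose
that at the maximizer `y₀` it is less than `φ x`, that is, that there is no support at `x`. By
Loeper's property the set of minimizers `z` at `y₀` is `c`-convex with respect to `y₀`. The envelope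
theorem (`Admissible.exists_argmin_inner_nonneg`) and a minimax theorem
(`exists_forall_inner_nonneg`) then produce a single minimizer `z` for which `y₀` is a first-order
maximum of `y ↦ c (z, y) - c (x, y)`. Loeper's property turns it into a global maximum
(`Loeper.cost_sub_le_of_firstOrder`), so no `c`-affine function through `(x, φ x)` lies below `φ` at
`z`, a contradiction.

*Failure of Loeper's property.* By duality there are an interior point `x`, a point `z` and slopes
`p` between `p₀` and `p₁` such that, among the `c`-affine functions vanishing at `x`, the one with
slope `p` exceeds at `z` those with slopes `p₀` and `p₁` (`Admissible.exists_dual_violation`). Take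
the supremum of the `c`-affine functions with slopes in small balls around `p₀` and `p₁`, and raise
it slightly near `x` so as to become `c`-affine with slope `p` there. At `x` the only possible
support has slope `p`, and it fails at `z`. On the other hand, two points can always be dealt with:
every direction has a nonpositive inner product with `p₀ - p` or with `p₁ - p`, so for any single
point near a raised one some slope near `p₀` or `p₁` works, and all these slopes work for the
distant points (`Admissible.exists_isAltCConvex_not_isCConvex`).
-/

open Set Filter Topology Metric

namespace OTCost

variable {n : ℕ} {X Y : Set (E n)} {c : E n → E n → ℝ}

/-! ### Dual coordinates -/

/-- The standing hypotheses on the domains and on the cost. -/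
structure Admissible (X Y : Set (E n)) (c : E n → E n → ℝ) : Prop where
  compactX : IsCompact X
  compactY : IsCompact Y
  interiorX : (interior X).Nonempty
  interiorY : (interior Y).Nonempty
  isC2 : IsC2 X Y c
  twisted : BiTwisted X Y c
  nonDegenerate : NonDegenerate X Y c
  convexX : CConvexSetX Y c X
  convexY : CConvexSetY X c Y

/-- The set `[Y]_x = -D_x c (x, Y)`, the domain of the dual coordinates at `x`. -/
def coordSet (X Y : Set (E n)) (c : E n → E n → ℝ) (x : E n) : Set (E n) :=
  (fun y => -gradX X c x y) '' Y

/-- The `c`-exponential map at `x`: the inverse of `-D_x c (x, ·)` on `Y`. Outside `coordSet` its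
values are irrelevant. -/
noncomputable def cExp (X Y : Set (E n)) (c : E n → E n → ℝ) (x : E n) : E n → E n :=
  Function.invFunOn (fun y => -gradX X c x y) Y

/-- The inverse of `-D²_{xy} c (x, y)`, which is the derivative of the `c`-exponential map. -/
noncomputable def hessInv (X Y : Set (E n)) (c : E n → E n → ℝ) (x y : E n) : E n →L[ℝ] E n :=
  (-hessXY X Y c x y).inverse

lemma isInvertible_adjoint {A : E n →L[ℝ] E n} (hA : A.IsInvertible) :
    (ContinuousLinearMap.adjoint A).IsInvertible := by
  refine ContinuousLinearMap.IsInvertible.of_inverse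
    (g := ContinuousLinearMap.adjoint A.inverse) ?_ ?_
  · rw [← ContinuousLinearMap.adjoint_comp, hA.inverse_comp_self, ContinuousLinearMap.adjoint_id]
  · rw [← ContinuousLinearMap.adjoint_comp, hA.self_comp_inverse, ContinuousLinearMap.adjoint_id]

namespace Admissible

/-- The hypotheses are symmetric under exchanging the roles of `X` and `Y`. -/
lemma swap (h : Admissible X Y c) : Admissible Y X (fun y x => c x y) where
  compactX := h.compactY
  compactY := h.compactX
  interiorX := h.interiorY
  interiorY := h.interiorX
  isC2 :=
    { diffX := fun y hy x hx => h.isC2.diffY x hx y hy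
      diffY := fun y hy x hx => h.isC2.diffX x hx y hy
      diffXY := fun y hy x hx => h.isC2.diffYX x hx y hy
      diffYX := fun y hy x hx => h.isC2.diffXY x hx y hy
      contXY := h.isC2.contYX.comp continuous_swap.continuousOn (fun _ hp => ⟨hp.2, hp.1⟩)
      contYX := h.isC2.contXY.comp continuous_swap.continuousOn (fun _ hp => ⟨hp.2, hp.1⟩)
      symm := fun y hy x hx => by
        change hessYX X Y c x y = ContinuousLinearMap.adjoint (hessXY X Y c x y)
        rw [h.isC2.symm x hx y hy, ContinuousLinearMap.adjoint_adjoint] }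
  twisted := ⟨h.twisted.2, h.twisted.1⟩
  nonDegenerate := fun y hy x hx => by
    change (-hessYX X Y c x y).IsInvertible
    have h1 := isInvertible_adjoint (h.nonDegenerate x hx y hy)
    rwa [map_neg, h.isC2.symm x hx y hy, ContinuousLinearMap.adjoint_adjoint] at h1
  convexX := h.convexY
  convexY := h.convexX

section Coordinates

variable {x y p : E n}

lemma hasFDerivWithinAt_coord (h : Admissible X Y c) (hx : x ∈ X) (hy : y ∈ Y) :
    HasFDerivWithinAt (fun y => -gradX X c x y) (-hessXY X Y c x y) Y y :=
  (h.isC2.diffXY x hx y hy).hasFDerivWithinAt.fun_neg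

lemma continuousOn_coord (h : Admissible X Y c) (hx : x ∈ X) :
    ContinuousOn (fun y => -gradX X c x y) Y :=
  fun _ hy => (h.hasFDerivWithinAt_coord hx hy).continuousWithinAt

lemma convex_coordSet (h : Admissible X Y c) (hx : x ∈ X) : Convex ℝ (coordSet X Y c x) :=
  h.convexY x hx

lemma isCompact_coordSet (h : Admissible X Y c) (hx : x ∈ X) : IsCompact (coordSet X Y c x) :=
  h.compactY.image_of_continuousOn (h.continuousOn_coord hx)

lemma coord_mem (hy : y ∈ Y) : -gradX X c x y ∈ coordSet X Y c x := mem_image_of_mem _ hy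

lemma cExp_mem (hp : p ∈ coordSet X Y c x) : cExp X Y c x p ∈ Y :=
  Function.invFunOn_mem hp

lemma coord_cExp (hp : p ∈ coordSet X Y c x) : -gradX X c x (cExp X Y c x p) = p :=
  Function.invFunOn_eq hp

lemma cExp_coord (h : Admissible X Y c) (hx : x ∈ X) (hy : y ∈ Y) :
    cExp X Y c x (-gradX X c x y) = y :=
  (h.twisted.1 x hx).leftInvOn_invFunOn hy

lemma continuousOn_cExp (h : Admissible X Y c) (hx : x ∈ X) :
    ContinuousOn (cExp X Y c x) (coordSet X Y c x) := by
  -- a continuous injection of a compact set is a homeomorphism onto its image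
  rw [continuousOn_iff_isClosed]
  intro t ht
  refine ⟨(fun y => -gradX X c x y) '' (Y ∩ t), ?_, ?_⟩
  · exact ((h.compactY.inter_right ht).image_of_continuousOn
      ((h.continuousOn_coord hx).mono inter_subset_left)).isClosed
  · ext p
    constructor
    · rintro ⟨hpt, hp⟩
      exact ⟨⟨_, ⟨cExp_mem hp, hpt⟩, coord_cExp hp⟩, hp⟩
    · rintro ⟨⟨y, ⟨hy, hyt⟩, rfl⟩, hp⟩
      refine ⟨?_, hp⟩
      simpa only [mem_preimage, h.cExp_coord hx hy] using hyt

lemma hasFDerivWithinAt_cExp (h : Admissible X Y c) (hx : x ∈ X) (hp : p ∈ coordSet X Y c x) :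
    HasFDerivWithinAt (cExp X Y c x) (hessInv X Y c x (cExp X Y c x p)) (coordSet X Y c x) p := by
  obtain ⟨e, he⟩ := h.nonDegenerate x hx _ (cExp_mem hp)
  have h1 := h.hasFDerivWithinAt_coord hx (cExp_mem hp)
  rw [← he] at h1
  rw [hessInv, ← he, ContinuousLinearMap.inverse_equiv]
  refine h1.of_local_left_inverse ?_ hp ?_
  · exact tendsto_nhdsWithin_iff.2 ⟨h.continuousOn_cExp hx p hp,
      eventually_nhdsWithin_of_forall fun q hq => cExp_mem hq⟩
  · exact eventually_nhdsWithin_of_forall fun q hq => coord_cExp hq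

lemma continuousOn_hessInv (h : Admissible X Y c) :
    ContinuousOn (fun z : E n × E n => hessInv X Y c z.1 z.2) (X ×ˢ Y) := fun z hz =>
  ContinuousAt.comp_continuousWithinAt (f := fun z : E n × E n => -hessXY X Y c z.1 z.2)
    ((h.nonDegenerate z.1 hz.1 z.2 hz.2).contDiffAt_map_inverse (n := 0)).continuousAt
    (h.isC2.contXY z hz).neg

lemma hessInv_isInvertible (h : Admissible X Y c) (hx : x ∈ X) (hy : y ∈ Y) :
    (hessInv X Y c x y).IsInvertible :=
  (h.nonDegenerate x hx y hy).inverse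

lemma inner_hessInv (h : Admissible X Y c) (hx : x ∈ X) (hy : y ∈ Y) (a b : E n) :
    inner ℝ (hessInv X Y c x y a) b = inner ℝ a (hessInv Y X (fun y x => c x y) y x b) := by
  have hA := h.nonDegenerate x hx y hy
  have hB := h.swap.nonDegenerate y hy x hx
  set A := -hessXY X Y c x y with hAdef
  set B := -hessXY Y X (fun y x => c x y) y x with hBdef
  have hAB : A = ContinuousLinearMap.adjoint B := by
    rw [hAdef, hBdef, map_neg, h.isC2.symm x hx y hy]
    rfl
  change inner ℝ (A.inverse a) b = inner ℝ a (B.inverse b)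
  conv_lhs => rw [← hB.self_apply_inverse b]
  rw [← ContinuousLinearMap.adjoint_inner_left, ← hAB, hA.self_apply_inverse]

lemma map_nhds_coord (h : Admissible X Y c) (hx : x ∈ X) (hy : y ∈ interior Y) :
    map (fun y => -gradX X c x y) (𝓝 y) = 𝓝 (-gradX X c x y) := by
  obtain ⟨e, he⟩ := h.nonDegenerate x hx y (interior_subset hy)
  have hs : HasStrictFDerivAt (fun y => -gradX X c x y) (e : E n →L[ℝ] E n) y := by
    rw [he]
    refine hasStrictFDerivAt_of_hasFDerivAt_of_continuousAt
      (f' := fun y => -hessXY X Y c x y) ?_ ?_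
    · filter_upwards [isOpen_interior.mem_nhds hy] with z hz
      exact (h.hasFDerivWithinAt_coord hx (interior_subset hz)).hasFDerivAt
        (mem_interior_iff_mem_nhds.1 hz)
    · have h1 : ContinuousOn (fun y => -hessXY X Y c x y) Y :=
        (h.isC2.contXY.comp (f := fun y => (x, y)) (by fun_prop) (fun y hy => ⟨hx, hy⟩)).neg
      exact h1.continuousAt (mem_interior_iff_mem_nhds.1 hy)
  exact hs.map_nhds_eq_of_equiv

lemma interior_coordSet_nonempty (h : Admissible X Y c) (hx : x ∈ X) :
    (interior (coordSet X Y c x)).Nonempty := by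
  obtain ⟨y, hy⟩ := h.interiorY
  refine ⟨-gradX X c x y, mem_interior_iff_mem_nhds.2 ?_⟩
  rw [← h.map_nhds_coord hx hy]
  exact image_mem_map (mem_interior_iff_mem_nhds.1 hy)

lemma cExp_mem_interior (h : Admissible X Y c) (hx : x ∈ X)
    (hp : p ∈ interior (coordSet X Y c x)) : cExp X Y c x p ∈ interior Y := by
  have hpm := interior_subset hp
  obtain ⟨e, he⟩ := h.hessInv_isInvertible hx (cExp_mem hpm)
  have hs : HasStrictFDerivAt (cExp X Y c x) (e : E n →L[ℝ] E n) p := by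
    rw [he]
    refine hasStrictFDerivAt_of_hasFDerivAt_of_continuousAt
      (f' := fun p => hessInv X Y c x (cExp X Y c x p)) ?_ ?_
    · filter_upwards [isOpen_interior.mem_nhds hp] with z hz
      exact (h.hasFDerivWithinAt_cExp hx (interior_subset hz)).hasFDerivAt
        (mem_interior_iff_mem_nhds.1 hz)
    · have h1 : ContinuousOn (fun p => hessInv X Y c x (cExp X Y c x p)) (coordSet X Y c x) :=
        h.continuousOn_hessInv.comp (f := fun p => (x, cExp X Y c x p))
          (continuousOn_const.prodMk (h.continuousOn_cExp hx)) (fun q hq => ⟨hx, cExp_mem hq⟩)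
      exact h1.continuousAt (mem_interior_iff_mem_nhds.1 hp)
  rw [mem_interior_iff_mem_nhds, ← hs.map_nhds_eq_of_equiv]
  refine mem_of_superset (image_mem_map (mem_interior_iff_mem_nhds.1 hp)) ?_
  rintro _ ⟨q, hq, rfl⟩
  exact cExp_mem hq

end Coordinates

end Admissible

/-! ### Joint continuity of the cost, and convexity in terms of supports -/

/-- A function of two variables that is continuous in the first one at a single value of the second
one is jointly continuous as soon as its derivative in the second variable is. -/
lemma continuousOn_prod_of_hasFDerivWithinAt {α F G : Type*} [TopologicalSpace α]
    [NormedAddCommGroup F] [NormedSpace ℝ F] [NormedAddCommGroup G] [NormedSpace ℝ G]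
    {S : Set α} {T : Set F} (hS : IsCompact S) (hT : IsCompact T) (hTc : Convex ℝ T)
    {k : α → F → G} {K : α → F → F →L[ℝ] G}
    (hk : ∀ a ∈ S, ∀ t ∈ T, HasFDerivWithinAt (k a) (K a t) T t)
    (hK : ContinuousOn (fun z : α × F => K z.1 z.2) (S ×ˢ T))
    {t₀ : F} (ht₀ : t₀ ∈ T) (hk₀ : ContinuousOn (fun a => k a t₀) S) :
    ContinuousOn (fun z : α × F => k z.1 z.2) (S ×ˢ T) := by
  obtain ⟨C, hC⟩ := (hS.prod hT).exists_bound_of_continuousOn hK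
  refine continuousOn_prod_of_continuousOn_lipschitzOnWith' (fun z : α × F => k z.1 z.2)
    (Real.toNNReal C) (fun a ha => ?_) (fun t ht a₀ ha₀ => ?_)
  · refine hTc.lipschitzOnWith_of_nnnorm_hasFDerivWithin_le (fun t ht => hk a ha t ht)
      (fun t ht => ?_)
    rw [← NNReal.coe_le_coe, coe_nnnorm]
    exact (hC (a, t) ⟨ha, ht⟩).trans (Real.le_coe_toNNReal C)
  · -- the increments of `k a - k a₀` between `t₀` and `t` are small, uniformly as `a → a₀`
    have h0 : Tendsto (fun a => (k a t - k a₀ t) - (k a t₀ - k a₀ t₀)) (𝓝[S] a₀) (𝓝 0) := by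
      rw [Metric.tendsto_nhds]
      intro ε hε
      have hM : 0 < ‖t - t₀‖ + 1 := by positivity
      obtain ⟨v, hv, hvK⟩ := hT.mem_uniformity_of_prod (f := K) hK ha₀
        (Metric.dist_mem_uniformity (div_pos hε hM))
      filter_upwards [hv, self_mem_nhdsWithin] with a hav ha
      rw [dist_zero_right]
      have h1 := hTc.norm_image_sub_le_of_norm_hasFDerivWithin_le
        (f := fun t => k a t - k a₀ t) (f' := fun t => K a t - K a₀ t) (C := ε / (‖t - t₀‖ + 1))
        (fun s hs => (hk a ha s hs).sub (hk a₀ ha₀ s hs))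
        (fun s hs => by
          have := hvK a hav s hs
          rw [← dist_eq_norm]
          exact le_of_lt this) ht₀ ht
      refine h1.trans_lt ?_
      rw [div_mul_eq_mul_div, div_lt_iff₀ hM]
      nlinarith
    have h2 : Tendsto (fun a => k a t₀) (𝓝[S] a₀) (𝓝 (k a₀ t₀)) := hk₀ a₀ ha₀
    have h3 := (h0.add (h2.sub_const (k a₀ t₀))).add_const (k a₀ t)
    simp only [sub_add_cancel, sub_self, zero_add] at h3
    exact h3

/-- First-order condition along a segment on which a function is maximal at its starting point. -/
lemma hasFDerivWithinAt_nonpos_of_le_segment {F : Type*} [NormedAddCommGroup F] [NormedSpace ℝ F]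
    {f : F → ℝ} {f' : F →L[ℝ] ℝ} {s : Set F} {p q : F} (hf : HasFDerivWithinAt f f' s p)
    (hs : segment ℝ p q ⊆ s) (hle : ∀ r ∈ segment ℝ p q, f r ≤ f p) : f' (q - p) ≤ 0 :=
  IsLocalMaxOn.hasFDerivWithinAt_nonpos
    (Filter.eventually_of_mem self_mem_nhdsWithin hle : IsLocalMaxOn f (segment ℝ p q) p)
    (hf.mono hs) (sub_mem_posTangentConeAt_of_segment_subset Subset.rfl)

/-- An affine function vanishing on a relative neighbourhood in a convex body has gradient zero. -/
lemma eq_zero_of_inner_eq_zero_near {P U : Set (E n)} (hP : Convex ℝ P)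
    (hPi : (interior P).Nonempty) {p p₀ ζ : E n} (hp : p ∈ P) (hU : U ∈ 𝓝 p)
    (h : ∀ r ∈ P, r ∈ U → inner ℝ (r - p₀) ζ = 0) : ζ = 0 := by
  have hpc : p ∈ closure (interior P) := by
    rw [hP.closure_interior_eq_closure_of_nonempty_interior hPi]
    exact subset_closure hp
  obtain ⟨r, hrU, hrP⟩ := mem_closure_iff_nhds.1 hpc _ (interior_mem_nhds.2 hU)
  have hW : P ∩ U ∈ 𝓝 r :=
    inter_mem (mem_interior_iff_mem_nhds.1 hrP) (mem_interior_iff_mem_nhds.1 hrU)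
  have ht : Tendsto (fun t : ℝ => r + t • ζ) (𝓝[≠] 0) (𝓝 r) := by
    have : Continuous fun t : ℝ => r + t • ζ := by fun_prop
    simpa using (this.tendsto 0).mono_left nhdsWithin_le_nhds
  obtain ⟨t, htW, ht0⟩ := ((ht.eventually_mem hW).and self_mem_nhdsWithin).exists
  have h1 := h _ htW.1 htW.2
  have h2 := h _ (mem_of_mem_nhds hW).1 (mem_of_mem_nhds hW).2
  rw [add_sub_right_comm, inner_add_left, h2, zero_add, inner_smul_left] at h1
  simpa using (mul_eq_zero.1 h1).resolve_left ht0

namespace Admissible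

variable {x x' y p : E n}

lemma continuousOn_of_hasFDerivWithinAt {G : Type*} [NormedAddCommGroup G] [NormedSpace ℝ G]
    (h : Admissible X Y c) {k : E n → E n → G} {K : E n → E n → E n →L[ℝ] G}
    (hk : ∀ x ∈ X, ∀ y ∈ Y, HasFDerivWithinAt (k x) (K x y) Y y)
    (hK : ContinuousOn (fun z : E n × E n => K z.1 z.2) (X ×ˢ Y))
    (hy : y ∈ Y) (hky : ContinuousOn (fun x => k x y) X) :
    ContinuousOn (fun z : E n × E n => k z.1 z.2) (X ×ˢ Y) := by
  obtain ⟨x₀, hx₀⟩ := h.interiorX.mono interior_subset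
  -- in the coordinates at `x₀` the domain `Y` becomes convex
  have h1 : ContinuousOn (fun z : E n × E n => k z.1 (cExp X Y c x₀ z.2))
      (X ×ˢ coordSet X Y c x₀) := by
    refine continuousOn_prod_of_hasFDerivWithinAt h.compactX (h.isCompact_coordSet hx₀)
      (h.convex_coordSet hx₀) (k := fun x p => k x (cExp X Y c x₀ p))
      (K := fun x p => K x (cExp X Y c x₀ p) ∘L hessInv X Y c x₀ (cExp X Y c x₀ p))
      (fun x hx p hp => ?_) ?_ (coord_mem hy) ?_
    · have h3 : MapsTo (cExp X Y c x₀) (coordSet X Y c x₀) Y := fun q hq => cExp_mem hq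
      have h4 := hk x hx (cExp X Y c x₀ p) (cExp_mem hp)
      exact h4.comp p (h.hasFDerivWithinAt_cExp hx₀ hp) h3
    · have he : ContinuousOn (fun z : E n × E n => cExp X Y c x₀ z.2) (X ×ˢ coordSet X Y c x₀) :=
        (h.continuousOn_cExp hx₀).comp continuousOn_snd (fun z hz => hz.2)
      have h3 : ContinuousOn (fun z : E n × E n => K z.1 (cExp X Y c x₀ z.2))
          (X ×ˢ coordSet X Y c x₀) :=
        hK.comp (f := fun z : E n × E n => (z.1, cExp X Y c x₀ z.2))
          (continuousOn_fst.prodMk he) (fun z hz => ⟨hz.1, cExp_mem hz.2⟩)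
      have h4 : ContinuousOn (fun z : E n × E n => hessInv X Y c x₀ (cExp X Y c x₀ z.2))
          (X ×ˢ coordSet X Y c x₀) :=
        h.continuousOn_hessInv.comp (f := fun z : E n × E n => (x₀, cExp X Y c x₀ z.2))
          (continuousOn_const.prodMk he) (fun z hz => ⟨hx₀, cExp_mem hz.2⟩)
      exact h3.clm_comp h4
    · simpa only [h.cExp_coord hx₀ hy] using hky
  have h2 : ContinuousOn (fun z : E n × E n => (z.1, -gradX X c x₀ z.2)) (X ×ˢ Y) :=
    continuousOn_fst.prodMk ((h.continuousOn_coord hx₀).comp continuousOn_snd fun z hz => hz.2)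
  refine (h1.comp h2 fun z hz => ⟨hz.1, coord_mem hz.2⟩).congr fun z hz => ?_
  simp only [Function.comp_apply, h.cExp_coord hx₀ hz.2]

/-- The gradient `D_x c` need not be continuous in `x`, but its increments in `y` are. -/
lemma continuousOn_gradX_sub (h : Admissible X Y c) (hy : y ∈ Y) :
    ContinuousOn (fun z : E n × E n => -gradX X c z.1 z.2 + gradX X c z.1 y) (X ×ˢ Y) := by
  refine h.continuousOn_of_hasFDerivWithinAt (k := fun x y' => -gradX X c x y' + gradX X c x y)
    (K := fun x y' => -hessXY X Y c x y') (fun x hx y' hy' => ?_) h.isC2.contXY.neg hy ?_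
  · exact (h.hasFDerivWithinAt_coord hx hy').add_const _
  · simpa using continuousOn_const

lemma continuousOn_gradY_sub (h : Admissible X Y c) (hx : x ∈ X) :
    ContinuousOn (fun z : E n × E n => -gradY Y c z.1 z.2 + gradY Y c x z.2) (X ×ˢ Y) := by
  have h1 : ContinuousOn (fun z : E n × E n => -gradY Y c z.2 z.1 + gradY Y c x z.1) (Y ×ˢ X) :=
    h.swap.continuousOn_gradX_sub hx
  exact h1.comp (f := Prod.swap) continuous_swap.continuousOn fun _ hz => ⟨hz.2, hz.1⟩

lemma hasFDerivWithinAt_cost_sub (h : Admissible X Y c) (hx : x ∈ X) (hx' : x' ∈ X) (hy : y ∈ Y) :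
    HasFDerivWithinAt (fun y => -c x' y + c x y)
      (innerSL ℝ (-gradY Y c x' y + gradY Y c x y)) Y y := by
  have h1 := (h.isC2.diffY x hx y hy).hasGradientWithinAt.hasFDerivWithinAt
  have h2 := (h.isC2.diffY x' hx' y hy).hasGradientWithinAt.hasFDerivWithinAt
  refine (h2.fun_neg.fun_add h1).congr_fderiv ?_
  ext v
  simp [gradY]

lemma continuousOn_cost_left (h : Admissible X Y c) (hy : y ∈ Y) : ContinuousOn (fun x => c x y) X :=
  fun x hx => (h.isC2.diffX x hx y hy).continuousWithinAt

lemma continuousOn_cost_right (h : Admissible X Y c) (hx : x ∈ X) : ContinuousOn (c x) Y :=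
  fun y hy => (h.isC2.diffY x hx y hy).continuousWithinAt

lemma continuousOn_cost (h : Admissible X Y c) :
    ContinuousOn (fun z : E n × E n => c z.1 z.2) (X ×ˢ Y) := by
  obtain ⟨x₀, hx₀⟩ := h.interiorX.mono interior_subset
  obtain ⟨y₀, hy₀⟩ := h.interiorY.mono interior_subset
  have h1 : ContinuousOn (fun z : E n × E n => -c z.1 z.2 + c x₀ z.2) (X ×ˢ Y) := by
    refine h.continuousOn_of_hasFDerivWithinAt (k := fun x y => -c x y + c x₀ y)
      (K := fun x y => innerSL ℝ (-gradY Y c x y + gradY Y c x₀ y))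
      (fun x hx y hy => h.hasFDerivWithinAt_cost_sub hx₀ hx hy)
      ((innerSL ℝ).continuous.comp_continuousOn (h.continuousOn_gradY_sub hx₀)) hy₀
      ((h.continuousOn_cost_left hy₀).neg.add continuousOn_const)
  have h2 : ContinuousOn (fun z : E n × E n => c x₀ z.2) (X ×ˢ Y) :=
    (h.continuousOn_cost_right hx₀).comp continuousOn_snd fun z hz => hz.2
  exact (h2.sub h1).congr fun z _ => by simp

/-- The derivative of a difference of costs in the dual coordinates at `x`. -/
lemma hasFDerivWithinAt_cost_cExp (h : Admissible X Y c) (hx : x ∈ X) (hx' : x' ∈ X)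
    (hp : p ∈ coordSet X Y c x) :
    HasFDerivWithinAt (fun p => -c x' (cExp X Y c x p) + c x (cExp X Y c x p))
      (innerSL ℝ (-gradY Y c x' (cExp X Y c x p) + gradY Y c x (cExp X Y c x p)) ∘L
        hessInv X Y c x (cExp X Y c x p)) (coordSet X Y c x) p :=
  (h.hasFDerivWithinAt_cost_sub hx hx' (cExp_mem hp)).comp p (h.hasFDerivWithinAt_cExp hx hp)
    fun _ hq => cExp_mem hq

end Admissible

/-- Alternative `c`-convexity in terms of supports: for any two points there is a `c`-affine
function that lies below `φ` at both of them and touches `φ` at the third point. -/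
lemma isAltCConvex_iff (hY : IsCompact Y) (hYn : Y.Nonempty) (hc : ∀ x ∈ X, ContinuousOn (c x) Y)
    {φ : X → ℝ} :
    IsAltCConvex X Y c φ ↔ ∀ x₀ x₁ x : X, ∃ y ∈ Y,
      φ x + c x y ≤ φ x₀ + c x₀ y ∧ φ x + c x y ≤ φ x₁ + c x₁ y := by
  refine forall_congr' fun x₀ => forall_congr' fun x₁ => forall_congr' fun x => ⟨fun h => ?_, ?_⟩
  · -- the best height over `y` is a continuous function of `y`, so the chord is attained
    obtain ⟨y, hy, hmax⟩ := hY.exists_isMaxOn hYn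
      (f := fun y => min (φ x₀ + c x₀ y) (φ x₁ + c x₁ y) - c x y)
      (((continuousOn_const.add (hc x₀ x₀.2)).inf (continuousOn_const.add (hc x₁ x₁.2))).sub
        (hc x x.2))
    have h1 : (φ x : EReal) ≤ ((min (φ x₀ + c x₀ y) (φ x₁ + c x₁ y) - c x y : ℝ) : EReal) := by
      refine h.trans (sSup_le ?_)
      rintro z ⟨y', hy', t, h₀, h₁, rfl⟩
      rw [EReal.coe_le_coe_iff]
      refine le_trans ?_ (hmax hy')
      have : t ≤ min (φ x₀ + c x₀ y') (φ x₁ + c x₁ y') := le_min (by linarith) (by linarith)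
      simp only
      linarith
    rw [EReal.coe_le_coe_iff] at h1
    exact ⟨y, hy, by linarith [min_le_left (φ x₀ + c x₀ y) (φ x₁ + c x₁ y)],
      by linarith [min_le_right (φ x₀ + c x₀ y) (φ x₁ + c x₁ y)]⟩
  · rintro ⟨y, hy, h₀, h₁⟩
    refine le_sSup ⟨y, hy, φ x + c x y, by linarith, by linarith, ?_⟩
    rw [neg_add_cancel_comm_assoc]

/-- `c`-convexity in terms of supports: at every point there is a `c`-affine function that lies
below `φ` and touches it there. -/
lemma isCConvex_iff (hY : IsCompact Y) (hXn : X.Nonempty) (hc : ∀ x ∈ X, ContinuousOn (c x) Y)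
    {φ : X → ℝ} :
    IsCConvex X Y c φ ↔ ∀ x : X, ∃ y ∈ Y, ∀ z : X, φ x + c x y ≤ φ z + c z y := by
  constructor
  · rintro ⟨ψ, hψt, -, hφ⟩ x
    have hle : ∀ (y : Y) (t : ℝ), ψ y = t → ∀ z : X, t ≤ φ z + c z y := fun y t ht z => by
      have h1 : ((-c z y + t : ℝ) : EReal) ≤ φ z := by
        rw [hφ z, EReal.coe_add, ← ht]
        exact le_iSup (fun y : Y => ((-c z y : ℝ) : EReal) + ψ y) y
      rw [EReal.coe_le_coe_iff] at h1
      linarith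
    -- almost touching supports exist by definition of the supremum; pass to the limit
    have happrox : ∀ k : ℕ, ∃ y : Y, ∀ z : X,
        φ x + c x y - 1 / ((k : ℝ) + 1) ≤ φ z + c z y := fun k => by
      have hk : (0 : ℝ) < 1 / ((k : ℝ) + 1) := by positivity
      have h1 : ((φ x - 1 / ((k : ℝ) + 1) : ℝ) : EReal) <
          ⨆ y : Y, (((-c x y : ℝ) : EReal) + ψ y) := by
        rw [← hφ x, EReal.coe_lt_coe_iff]
        linarith
      obtain ⟨y, hy⟩ := lt_iSup_iff.1 h1
      have hbot : ψ y ≠ ⊥ := fun hb => by simp [hb] at hy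
      lift ψ y to ℝ using ⟨hψt y, hbot⟩ with t ht
      rw [← EReal.coe_add, EReal.coe_lt_coe_iff] at hy
      exact ⟨y, fun z => by linarith [hle y t ht.symm z]⟩
    choose u hu using happrox
    obtain ⟨y, hy, σ, hσ, hlim⟩ := hY.tendsto_subseq fun k => (u k).2
    refine ⟨y, hy, fun z => ?_⟩
    have hlim' : Tendsto (fun k => (u (σ k) : E n)) atTop (𝓝[Y] y) :=
      tendsto_nhdsWithin_iff.2 ⟨hlim, Eventually.of_forall fun k => (u (σ k)).2⟩
    have h1 := ((hc x x.2 y hy).tendsto.comp hlim').const_add (φ x) |>.sub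
      (tendsto_one_div_add_atTop_nhds_zero_nat.comp hσ.tendsto_atTop)
    have h2 := ((hc z z.2 y hy).tendsto.comp hlim').const_add (φ z)
    rw [sub_zero] at h1
    exact le_of_tendsto_of_tendsto' h1 h2 fun k => hu (σ k) z
  · intro h
    obtain ⟨x₀, hx₀⟩ := hXn
    have hψ : ∀ (y : Y) (z : X),
        (⨅ z : X, ((φ z + c z y : ℝ) : EReal)) ≤ ((φ z + c z y : ℝ) : EReal) :=
      fun y z => iInf_le _ z
    refine ⟨fun y => ⨅ z : X, ((φ z + c z y : ℝ) : EReal), fun y => ?_, ?_, fun x => ?_⟩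
    · exact ((hψ y ⟨x₀, hx₀⟩).trans_lt (EReal.coe_lt_top _)).ne
    · obtain ⟨y, hy, hsup⟩ := h ⟨x₀, hx₀⟩
      refine ⟨⟨y, hy⟩, ((EReal.bot_lt_coe (φ ⟨x₀, hx₀⟩ + c x₀ y)).trans_le ?_).ne'⟩
      exact le_iInf fun z => EReal.coe_le_coe_iff.2 (hsup z)
    · apply le_antisymm
      · obtain ⟨y, hy, hsup⟩ := h x
        refine le_trans ?_ (le_iSup (fun y : Y => ((-c x y : ℝ) : EReal) +
          ⨅ z : X, ((φ z + c z y : ℝ) : EReal)) ⟨y, hy⟩)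
        calc (φ x : EReal) = ((-c x y : ℝ) : EReal) + ((φ x + c x y : ℝ) : EReal) := by
              rw [← EReal.coe_add, neg_add_cancel_comm_assoc]
          _ ≤ _ := by
              gcongr
              exact le_iInf fun z => EReal.coe_le_coe_iff.2 (hsup z)
      · refine iSup_le fun y => ?_
        calc ((-c x y : ℝ) : EReal) + ⨅ z : X, ((φ z + c z y : ℝ) : EReal)
            ≤ ((-c x y : ℝ) : EReal) + ((φ x + c x y : ℝ) : EReal) := by
              gcongr
              exact hψ y x
          _ = φ x := by rw [← EReal.coe_add, neg_add_cancel_comm_assoc]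

/-- A `c`-convex function is alternative `c`-convex; no property of the cost is needed. -/
lemma IsCConvex.isAltCConvex (hY : IsCompact Y) (hXn : X.Nonempty) (hYn : Y.Nonempty)
    (hc : ∀ x ∈ X, ContinuousOn (c x) Y) {φ : X → ℝ} (h : IsCConvex X Y c φ) :
    IsAltCConvex X Y c φ :=
  (isAltCConvex_iff hY hYn hc).2 fun x₀ x₁ x =>
    let ⟨y, hy, hle⟩ := (isCConvex_iff hY hXn hc).1 h x
    ⟨y, hy, hle x₀, hle x₁⟩

/-! ### Global supports under Loeper's property -/

/-- A bilinear minimax theorem. -/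
lemma exists_forall_inner_nonneg {P K : Set (E n)} (hPc : Convex ℝ P) (hP : IsCompact P)
    (hPn : P.Nonempty) (hKc : Convex ℝ K) (hK : IsCompact K) (hKn : K.Nonempty)
    (B : E n →L[ℝ] E n) (p₀ q₀ : E n)
    (h : ∀ p ∈ P, ∃ q ∈ K, 0 ≤ inner ℝ (p - p₀) (B (q - q₀))) :
    ∃ q ∈ K, ∀ p ∈ P, 0 ≤ inner ℝ (p - p₀) (B (q - q₀)) := by
  have hl : ∀ q, (fun p => inner ℝ (p - p₀) (B (q - q₀))) =
      fun p => (innerSL ℝ (B (q - q₀))).toLinearMap p + -inner ℝ p₀ (B (q - q₀)) := fun q => by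
    funext p
    change _ = inner ℝ (B (q - q₀)) p + _
    rw [real_inner_comm p, inner_sub_left, sub_eq_add_neg]
  have hr : ∀ p, (fun q => inner ℝ (p - p₀) (B (q - q₀))) =
      fun q => (innerSL ℝ (p - p₀) ∘L B).toLinearMap q + -inner ℝ (p - p₀) (B q₀) := fun p => by
    funext q
    change _ = inner ℝ (p - p₀) (B q) + _
    rw [map_sub, inner_sub_right, sub_eq_add_neg]
  obtain ⟨a, ha, b, hb, hab⟩ := Sion.exists_isSaddlePointOn hPn hPc hP
    (f := fun p q => inner ℝ (p - p₀) (B (q - q₀)))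
    (fun q _ => (Continuous.lowerSemicontinuous (by fun_prop)).lowerSemicontinuousOn _)
    (fun q _ => by
      rw [hl]
      exact ((LinearMap.convexOn _ hPc).add_const _).quasiconvexOn)
    hKc hKn hK
    (fun p _ => (Continuous.upperSemicontinuous (by fun_prop)).upperSemicontinuousOn _)
    (fun p _ => by
      rw [hr]
      exact ((LinearMap.concaveOn _ hKc).add_const _).quasiconcaveOn)
  refine ⟨b, hb, fun p hp => ?_⟩
  obtain ⟨q, hq, hq0⟩ := h a ha
  exact hq0.trans (hab p hp q hq)

namespace Admissible

variable {x x' y p : E n}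

lemma hasFDerivWithinAt_cost_cExp_coord (h : Admissible X Y c) (hx : x ∈ X) (hx' : x' ∈ X)
    (hy : y ∈ Y) :
    HasFDerivWithinAt (fun p => -c x' (cExp X Y c x p) + c x (cExp X Y c x p))
      (innerSL ℝ (-gradY Y c x' y + gradY Y c x y) ∘L hessInv X Y c x y)
      (coordSet X Y c x) (-gradX X c x y) := by
  simpa only [h.cExp_coord hx hy] using h.hasFDerivWithinAt_cost_cExp hx hx' (coord_mem hy)

lemma hasFDerivWithinAt_cost_cExp_swap (h : Admissible X Y c) {y₀ : E n} (hx : x ∈ X)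
    (hy₀ : y₀ ∈ Y) (hy : y ∈ Y) :
    HasFDerivWithinAt (fun q => -c (cExp Y X (fun y x => c x y) y₀ q) y +
        c (cExp Y X (fun y x => c x y) y₀ q) y₀)
      (innerSL ℝ (-gradX X c x y + gradX X c x y₀) ∘L hessInv Y X (fun y x => c x y) y₀ x)
      (coordSet Y X (fun y x => c x y) y₀) (-gradY Y c x y₀) :=
  h.swap.hasFDerivWithinAt_cost_cExp_coord hy₀ hy hx

lemma cExp_gradY (h : Admissible X Y c) (hx : x ∈ X) (hy : y ∈ Y) :
    cExp Y X (fun y x => c x y) y (-gradY Y c x y) = x :=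
  h.swap.cExp_coord hy hx

lemma gradY_cExp {q : E n} (hq : q ∈ coordSet Y X (fun y x => c x y) y) :
    -gradY Y c (cExp Y X (fun y x => c x y) y q) y = q :=
  coord_cExp hq

lemma cExp_mem_cSegment {x₀ x₁ q : E n} (hq : q ∈ coordSet Y X (fun y x => c x y) y)
    (hqs : q ∈ segment ℝ (-gradY Y c x₀ y) (-gradY Y c x₁ y)) :
    cExp Y X (fun y x => c x y) y q ∈ cSegment X Y c y x₀ x₁ :=
  ⟨cExp_mem hq, by rwa [gradY_cExp hq]⟩

end Admissible

/-- Under Loeper's property, a first-order condition at `y₀` for the difference of the costs from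
`z` and from `x` forces `y₀` to be a global maximum of that difference. Otherwise, for every `y` in
a relatively open set of larger values, `-c (·, y) + c (·, y₀)` is maximal at `x` on the
`c`-segment from `x` to `z`. Its derivative there has then both signs, so it vanishes for all these
`y`, and non-degeneracy gives `z = x`. -/
lemma Loeper.cost_sub_le_of_firstOrder (hL : Loeper X Y c) (h : Admissible X Y c) {x z y₀ : E n}
    (hx : x ∈ X) (hz : z ∈ X) (hy₀ : y₀ ∈ Y)
    (hfo : ∀ p ∈ coordSet X Y c x, 0 ≤ inner ℝ (p - -gradX X c x y₀)
      (hessInv Y X (fun y x => c x y) y₀ x (-gradY Y c z y₀ - -gradY Y c x y₀)))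
    {y : E n} (hy : y ∈ Y) : c z y - c x y ≤ c z y₀ - c x y₀ := by
  by_contra! hlt
  set c' : E n → E n → ℝ := fun y x => c x y with hc'
  set ζ := hessInv Y X c' y₀ x (-gradY Y c z y₀ - -gradY Y c x y₀) with hζ
  have hcont : ContinuousOn (fun p => c z (cExp X Y c x p) - c x (cExp X Y c x p))
      (coordSet X Y c x) :=
    ((h.continuousOn_cost_right hz).sub (h.continuousOn_cost_right hx)).comp
      (h.continuousOn_cExp hx) fun p hp => Admissible.cExp_mem hp
  have hev : ∀ᶠ p in 𝓝[coordSet X Y c x] (-gradX X c x y),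
      c z y₀ - c x y₀ < c z (cExp X Y c x p) - c x (cExp X Y c x p) := by
    refine (hcont _ (Admissible.coord_mem hy)).eventually (lt_mem_nhds ?_)
    simpa only [h.cExp_coord hx hy] using hlt
  obtain ⟨U, hU, hUP⟩ := mem_nhdsWithin_iff_exists_mem_nhds_inter.1 hev
  have hzero : ζ = 0 := by
    refine eq_zero_of_inner_eq_zero_near (h.convex_coordSet hx) (h.interior_coordSet_nonempty hx)
      (p₀ := -gradX X c x y₀) (Admissible.coord_mem hy) hU fun p hp hpU => ?_
    refine le_antisymm ?_ (hfo p hp)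
    have hlt' : c z y₀ - c x y₀ < c z (cExp X Y c x p) - c x (cExp X Y c x p) := hUP ⟨hpU, hp⟩
    have hseg : segment ℝ (-gradY Y c x y₀) (-gradY Y c z y₀) ⊆ coordSet Y X c' y₀ :=
      (h.swap.convex_coordSet hy₀).segment_subset (Admissible.coord_mem (c := c') hx)
        (Admissible.coord_mem (c := c') hz)
    have h1 := hasFDerivWithinAt_nonpos_of_le_segment
      (h.hasFDerivWithinAt_cost_cExp_swap hx hy₀ (Admissible.cExp_mem hp)) hseg fun q hq => by
        have h2 := hL x hx z hz y₀ hy₀ _ (Admissible.cExp_mem hp) _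
          (Admissible.cExp_mem_cSegment (hseg hq) hq)
        rw [max_eq_left (by linarith)] at h2
        rwa [h.cExp_gradY hx hy₀]
    rw [ContinuousLinearMap.comp_apply, innerSL_apply_apply, ← sub_neg_eq_add,
      Admissible.coord_cExp hp] at h1
    exact h1
  have h1 := (h.swap.hessInv_isInvertible hy₀ hx).injective (hzero.trans (map_zero _).symm)
  have h2 : z = x := by
    rw [← h.cExp_gradY hz hy₀, sub_eq_zero.1 h1, h.cExp_gradY hx hy₀]
  subst h2
  linarith

/-- An envelope theorem: at a point `y₀` where `y ↦ min_z (f z + c z y - c x y)` is maximal, the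
derivative in any admissible direction is nonpositive at one of the minimizers. -/
lemma Admissible.exists_argmin_inner_nonneg (h : Admissible X Y c) {f : E n → ℝ}
    (hf : ContinuousOn f X) {x y₀ p : E n} (hx : x ∈ X) (hy₀ : y₀ ∈ Y) {μ : ℝ}
    (hmin : ∀ z ∈ X, μ ≤ f z + c z y₀ - c x y₀)
    (hmax : ∀ y ∈ Y, ∃ z ∈ X, f z + c z y - c x y ≤ μ) (hp : p ∈ coordSet X Y c x) :
    ∃ z ∈ X, f z + c z y₀ - c x y₀ ≤ μ ∧ 0 ≤ inner ℝ (p - -gradX X c x y₀)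
      (hessInv Y X (fun y x => c x y) y₀ x (-gradY Y c z y₀ - -gradY Y c x y₀)) := by
  set v := p - -gradX X c x y₀ with hv
  set γ : ℝ → E n := fun s => -gradX X c x y₀ + s • v with hγ
  set η : ℝ → E n := fun s => cExp X Y c x (γ s) with hη
  have hγP : ∀ s ∈ Icc (0 : ℝ) 1, γ s ∈ coordSet X Y c x := fun s hs =>
    (h.convex_coordSet hx).add_smul_sub_mem (coord_mem hy₀) hp hs
  have hγ0 : γ 0 = -gradX X c x y₀ := by simp [hγ]
  have hη0 : η 0 = y₀ := by simp only [hη, hγ0, h.cExp_coord hx hy₀]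
  have hηY : ∀ s ∈ Icc (0 : ℝ) 1, η s ∈ Y := fun s hs => cExp_mem (hγP s hs)
  have hηc : ContinuousOn η (Icc 0 1) :=
    (h.continuousOn_cExp hx).comp (f := γ) (by fun_prop) hγP
  set D : E n → ℝ → ℝ := fun z s =>
    inner ℝ (-gradY Y c z (η s) + gradY Y c x (η s)) (hessInv X Y c x (η s) v) with hD
  have hDd : ∀ z ∈ X, ∀ s ∈ Icc (0 : ℝ) 1,
      HasDerivWithinAt (fun s => -c z (η s) + c x (η s)) (D z s) (Icc 0 1) s := fun z hz s hs => by
    have h1 : HasDerivWithinAt γ v (Icc 0 1) s :=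
      (((hasDerivAt_id' s).smul_const v).const_add (-gradX X c x y₀)).hasDerivWithinAt.congr_deriv
        (one_smul ℝ v)
    exact (h.hasFDerivWithinAt_cost_cExp hx hz (hγP s hs)).comp_hasDerivWithinAt s h1 hγP
  have hηc2 : ContinuousOn (fun w : E n × ℝ => η w.2) (X ×ˢ Icc 0 1) :=
    hηc.comp continuousOn_snd fun w hw => hw.2
  have hDc : ContinuousOn (fun w : E n × ℝ => D w.1 w.2) (X ×ˢ Icc 0 1) := by
    have h1 : ContinuousOn (fun w : E n × ℝ => -gradY Y c w.1 (η w.2) + gradY Y c x (η w.2))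
        (X ×ˢ Icc 0 1) :=
      (h.continuousOn_gradY_sub hx).comp (f := fun w : E n × ℝ => (w.1, η w.2))
        (continuousOn_fst.prodMk hηc2) fun w hw => ⟨hw.1, hηY _ hw.2⟩
    have h2 : ContinuousOn (fun w : E n × ℝ => hessInv X Y c x (η w.2)) (X ×ˢ Icc 0 1) :=
      h.continuousOn_hessInv.comp (f := fun w : E n × ℝ => (x, η w.2))
        (continuousOn_const.prodMk hηc2) fun w hw => ⟨hx, hηY _ hw.2⟩
    exact h1.inner (h2.clm_apply continuousOn_const)
  have hΦc : ContinuousOn (fun w : E n × ℝ => f w.1 + c w.1 (η w.2) - c x (η w.2))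
      (X ×ˢ Icc 0 1) := by
    have h1 : ContinuousOn (fun w : E n × ℝ => c w.1 (η w.2)) (X ×ˢ Icc 0 1) :=
      h.continuousOn_cost.comp (f := fun w : E n × ℝ => (w.1, η w.2))
        (continuousOn_fst.prodMk hηc2) fun w hw => ⟨hw.1, hηY _ hw.2⟩
    have h2 : ContinuousOn (fun w : E n × ℝ => c x (η w.2)) (X ×ˢ Icc 0 1) :=
      (h.continuousOn_cost_right hx).comp hηc2 fun w hw => hηY _ hw.2
    exact ((hf.comp continuousOn_fst fun w hw => hw.1).add h1).sub h2
  -- minimizers for the parameters `s → 0`, and the mean value theorem between `0` and `s`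
  have hseq : ∀ k : ℕ, ∃ w : (E n × ℝ) × ℝ, w ∈ (X ×ˢ Icc 0 1) ×ˢ Icc 0 1 ∧
      f w.1.1 + c w.1.1 (η w.1.2) - c x (η w.1.2) ≤ μ ∧ 0 ≤ D w.1.1 w.2 ∧
      w.1.2 ≤ 1 / ((k : ℝ) + 1) ∧ w.2 ≤ 1 / ((k : ℝ) + 1) := fun k => by
    set s : ℝ := 1 / ((k : ℝ) + 1) with hs
    have hs0 : 0 < s := by positivity
    have hs1 : s ≤ 1 := by
      rw [hs, div_le_one (by positivity)]
      linarith [(Nat.cast_nonneg k : (0 : ℝ) ≤ k)]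
    have hsI : s ∈ Icc (0 : ℝ) 1 := ⟨hs0.le, hs1⟩
    obtain ⟨z, hz, hzμ⟩ := hmax (η s) (hηY s hsI)
    have hsub : Icc 0 s ⊆ Icc (0 : ℝ) 1 := Icc_subset_Icc_right hs1
    obtain ⟨θ, hθ, hθD⟩ := exists_hasDerivAt_eq_slope (fun s => -c z (η s) + c x (η s)) (D z) hs0
      (fun t ht => (hDd z hz t (hsub ht)).continuousWithinAt.mono hsub)
      (fun t ht => (hDd z hz t (hsub (Ioo_subset_Icc_self ht))).hasDerivAt
        (Icc_mem_nhds ht.1 (ht.2.trans_le hs1)))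
    refine ⟨((z, s), θ), ⟨⟨hz, hsI⟩, hsub (Ioo_subset_Icc_self hθ)⟩, hzμ, ?_, le_rfl, hθ.2.le⟩
    change 0 ≤ D z θ
    rw [hθD, hη0]
    have := hmin z hz
    exact div_nonneg (by linarith) (by linarith)
  choose w hw hwμ hwD hws hwθ using hseq
  obtain ⟨⟨⟨z, s⟩, θ⟩, ⟨⟨hz, hs⟩, hθ⟩, σ, hσ, hlim⟩ :=
    ((h.compactX.prod isCompact_Icc).prod isCompact_Icc).tendsto_subseq hw
  simp only at hz hs hθ
  have hσlim : Tendsto (fun k => 1 / ((σ k : ℝ) + 1)) atTop (𝓝 0) :=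
    tendsto_one_div_add_atTop_nhds_zero_nat.comp hσ.tendsto_atTop
  have hl1 : Tendsto (fun k => (w (σ k)).1) atTop (𝓝 (z, s)) := hlim.fst_nhds
  have hl2 : Tendsto (fun k => (w (σ k)).2) atTop (𝓝 θ) := hlim.snd_nhds
  obtain rfl : s = 0 := le_antisymm (le_of_tendsto_of_tendsto' hl1.snd_nhds hσlim
    fun k => hws (σ k)) hs.1
  obtain rfl : θ = 0 := le_antisymm (le_of_tendsto_of_tendsto' hl2 hσlim
    fun k => hwθ (σ k)) hθ.1
  refine ⟨z, hz, ?_, ?_⟩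
  · have h1 := (hΦc (z, 0) ⟨hz, hs⟩).tendsto.comp (tendsto_nhdsWithin_iff.2
      ⟨hl1, Eventually.of_forall fun k => (hw (σ k)).1⟩)
    have h2 := le_of_tendsto' h1 fun k => hwμ (σ k)
    simpa only [hη0] using h2
  · have h1 := (hDc (z, 0) ⟨hz, hθ⟩).tendsto.comp (tendsto_nhdsWithin_iff.2
      ⟨hl1.fst_nhds.prodMk_nhds hl2,
        Eventually.of_forall fun k => ⟨(hw (σ k)).1.1, (hw (σ k)).2⟩⟩)
    have h2 : 0 ≤ D z 0 := ge_of_tendsto' h1 fun k => hwD (σ k)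
    rw [← h.inner_hessInv hx hy₀, real_inner_comm, sub_neg_eq_add]
    simpa only [hD, hη0] using h2

/-- Under Loeper's property, a function with common supports for any two points has a global
support at every point. -/
lemma Loeper.exists_support (hL : Loeper X Y c) (h : Admissible X Y c) {f : E n → ℝ}
    (hf : ∀ x₀ ∈ X, ∀ x₁ ∈ X, ∀ x ∈ X, ∃ y ∈ Y,
      f x + c x y ≤ f x₀ + c x₀ y ∧ f x + c x y ≤ f x₁ + c x₁ y) {x : E n} (hx : x ∈ X) :
    ∃ y ∈ Y, ∀ z ∈ X, f x + c x y ≤ f z + c z y := by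
  -- the increments of `f` are controlled by those of the costs
  have hfc : ContinuousOn f X := fun a ha => by
    rw [ContinuousWithinAt, Metric.tendsto_nhds]
    intro ε hε
    obtain ⟨v, hv, hvK⟩ := h.compactY.mem_uniformity_of_prod (f := c) h.continuousOn_cost ha
      (Metric.dist_mem_uniformity hε)
    filter_upwards [hv, self_mem_nhdsWithin] with b hbv hb
    obtain ⟨y, hy, hy1, -⟩ := hf b hb b hb a ha
    obtain ⟨y', hy', hy1', -⟩ := hf a ha a ha b hb
    have h1 : |c b y - c a y| < ε := hvK b hbv y hy
    have h2 : |c b y' - c a y'| < ε := hvK b hbv y' hy'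
    rw [Real.dist_eq, abs_lt]
    rw [abs_lt] at h1 h2
    constructor <;> linarith
  have hΦc : ContinuousOn (fun w : E n × E n => f w.1 + c w.1 w.2 - c x w.2) (X ×ˢ Y) :=
    ((hfc.comp continuousOn_fst fun w hw => hw.1).add h.continuousOn_cost).sub
      ((h.continuousOn_cost_right hx).comp continuousOn_snd fun w hw => hw.2)
  have hcomp : ∀ y ∈ Y, ContinuousOn (fun z => f z + c z y - c x y) X := fun y hy =>
    hΦc.comp (f := fun z => (z, y)) (by fun_prop) fun z hz => ⟨hz, hy⟩
  have hcomp' : ∀ z ∈ X, ContinuousOn (fun y => f z + c z y - c x y) Y := fun z hz =>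
    hΦc.comp (f := fun y => (z, y)) (by fun_prop) fun y hy => ⟨hz, hy⟩
  have hminex : ∀ y : E n, ∃ z, y ∈ Y → z ∈ X ∧ IsMinOn (fun z => f z + c z y - c x y) X z :=
    fun y => by
      by_cases hy : y ∈ Y
      · obtain ⟨z, hz, hzm⟩ := h.compactX.exists_isMinOn ⟨x, hx⟩ (hcomp y hy)
        exact ⟨z, fun _ => ⟨hz, hzm⟩⟩
      · exact ⟨x, fun hy' => absurd hy' hy⟩
  choose ζ hζ using hminex
  obtain ⟨y₀, hy₀, hmax₀⟩ := UpperSemicontinuousOn.exists_isMaxOn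
    (f := fun y => f (ζ y) + c (ζ y) y - c x y) (h.interiorY.mono interior_subset) h.compactY
    (fun y hy t ht => by
      filter_upwards [(hcomp' _ (hζ y hy).1 y hy).eventually (gt_mem_nhds ht),
        self_mem_nhdsWithin] with y' hy' hy'Y
      exact ((hζ y' hy'Y).2 (hζ y hy).1).trans_lt hy')
  set μ := f (ζ y₀) + c (ζ y₀) y₀ - c x y₀ with hμ
  have hmin : ∀ z ∈ X, μ ≤ f z + c z y₀ - c x y₀ := fun z hz => (hζ y₀ hy₀).2 hz
  have hmax : ∀ y ∈ Y, ∃ z ∈ X, f z + c z y - c x y ≤ μ := fun y hy =>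
    ⟨ζ y, (hζ y hy).1, hmax₀ hy⟩
  rcases le_or_gt (f x) μ with hle | hlt
  · exact ⟨y₀, hy₀, fun z hz => by linarith [hmin z hz]⟩
  exfalso
  set c' : E n → E n → ℝ := fun y x => c x y with hc'
  -- the set of minimizers at `y₀` is compact and `c`-convex
  set M : Set (E n) := {z ∈ X | f z + c z y₀ - c x y₀ ≤ μ} with hM
  have hMc : IsCompact M := by
    have h1 := (hcomp y₀ hy₀).preimage_isClosed_of_isClosed h.compactX.isClosed isClosed_Iic
      (t := Iic μ)
    exact h.compactX.of_isClosed_subset h1 fun z hz => hz.1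
  have hK : IsCompact ((fun z => -gradY Y c z y₀) '' M) :=
    hMc.image_of_continuousOn ((h.swap.continuousOn_coord hy₀).mono fun z hz => hz.1)
  have hKc : Convex ℝ ((fun z => -gradY Y c z y₀) '' M) := by
    rw [convex_iff_segment_subset]
    rintro _ ⟨z₀, hz₀, rfl⟩ _ ⟨z₁, hz₁, rfl⟩ q hq
    have hqQ : q ∈ coordSet Y X c' y₀ := (h.swap.convex_coordSet hy₀).segment_subset
      (Admissible.coord_mem (c := c') hz₀.1) (Admissible.coord_mem (c := c') hz₁.1) hq
    have hzQ := Admissible.cExp_mem hqQ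
    refine ⟨cExp Y X c' y₀ q, ⟨hzQ, ?_⟩, Admissible.gradY_cExp hqQ⟩
    obtain ⟨y, hy, h₀, h₁⟩ := hf z₀ hz₀.1 z₁ hz₁.1 _ hzQ
    have h2 := hL z₀ hz₀.1 z₁ hz₁.1 y₀ hy₀ y hy _ (Admissible.cExp_mem_cSegment hqQ hq)
    have h3 := hz₀.2
    have h4 := hz₁.2
    rcases le_max_iff.1 h2 with h2 | h2 <;> linarith
  obtain ⟨_, ⟨z, hz, rfl⟩, hfo⟩ := exists_forall_inner_nonneg (h.convex_coordSet hx)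
    (h.isCompact_coordSet hx) ⟨_, Admissible.coord_mem hy₀⟩ hKc hK
    ⟨_, mem_image_of_mem _ (⟨(hζ y₀ hy₀).1, le_rfl⟩ : ζ y₀ ∈ M)⟩
    (hessInv Y X c' y₀ x) (-gradX X c x y₀) (-gradY Y c x y₀) (fun p hp => by
      obtain ⟨z, hz, hzμ, h1⟩ := h.exists_argmin_inner_nonneg hfc hx hy₀ hmin hmax hp
      exact ⟨_, mem_image_of_mem _ (⟨hz, hzμ⟩ : z ∈ M), h1⟩)
  obtain ⟨y, hy, hyz, -⟩ := hf z hz.1 z hz.1 x hx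
  have h1 := hL.cost_sub_le_of_firstOrder h hx hz.1 hy₀ hfo hy
  linarith [hz.2]

/-- Under Loeper's property, alternative `c`-convexity implies `c`-convexity. -/
lemma Loeper.isCConvex (hL : Loeper X Y c) (h : Admissible X Y c) {φ : X → ℝ}
    (hφ : IsAltCConvex X Y c φ) : IsCConvex X Y c φ := by
  have hXn := h.interiorX.mono interior_subset
  have hYn := h.interiorY.mono interior_subset
  rw [isAltCConvex_iff h.compactY hYn fun x hx => h.continuousOn_cost_right hx] at hφ
  rw [isCConvex_iff h.compactY hXn fun x hx => h.continuousOn_cost_right hx]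
  have hext : ∀ x : X, Function.extend Subtype.val φ 0 (x : E n) = φ x :=
    Subtype.val_injective.extend_apply φ 0
  intro x
  obtain ⟨y, hy, hsup⟩ := hL.exists_support h (f := Function.extend Subtype.val φ 0)
    (fun x₀ hx₀ x₁ hx₁ x hx => by
      simpa only [← hext] using hφ ⟨x₀, hx₀⟩ ⟨x₁, hx₁⟩ ⟨x, hx⟩) x.2
  exact ⟨y, hy, fun z => by simpa only [hext] using hsup z z.2⟩

/-! ### A counterexample when Loeper's property fails -/

/-- The `c`-affine function of `w` that has slope `p` at `x` and vanishes at `x`. -/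
noncomputable def cAffine (X Y : Set (E n)) (c : E n → E n → ℝ) (x p w : E n) : ℝ :=
  -c w (cExp X Y c x p) + c x (cExp X Y c x p)

lemma cAffine_self (x p : E n) : cAffine X Y c x p x = 0 := neg_add_cancel _

/-- A violation of quasiconvexity along a segment can be moved into the interior. -/
lemma exists_violation_interior {P : Set (E n)} (hP : Convex ℝ P) (hPi : (interior P).Nonempty)
    {g : E n → ℝ} (hg : ContinuousOn g P) {p₀ p₁ p : E n} (hp₀ : p₀ ∈ P) (hp₁ : p₁ ∈ P)
    (hp : p ∈ segment ℝ p₀ p₁) (h₀ : g p₀ < g p) (h₁ : g p₁ < g p) :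
    ∃ p₀' ∈ interior P, ∃ p₁' ∈ interior P, ∃ p' ∈ segment ℝ p₀' p₁',
      g p₀' < g p' ∧ g p₁' < g p' := by
  obtain ⟨o, ho⟩ := hPi
  have hmem : ∀ r ∈ P, ∀ t ∈ Ioc (0 : ℝ) 1, r + t • (o - r) ∈ interior P := fun r hr t ht =>
    hP.add_smul_sub_mem_interior hr ho ht
  have hlim : ∀ r ∈ P, Tendsto (fun t : ℝ => g (r + t • (o - r))) (𝓝[>] 0) (𝓝 (g r)) :=
    fun r hr => by
      refine (hg r hr).tendsto.comp (tendsto_nhdsWithin_iff.2 ⟨?_, ?_⟩)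
      · have : Continuous fun t : ℝ => r + t • (o - r) := by fun_prop
        simpa using (this.tendsto 0).mono_left nhdsWithin_le_nhds
      · filter_upwards [Ioc_mem_nhdsGT (zero_lt_one' ℝ)] with t ht
        exact interior_subset (hmem r hr t ht)
  have hpP := hP.segment_subset hp₀ hp₁ hp
  obtain ⟨t, ⟨ht₀, ht₁⟩, ht⟩ := (((hlim p₀ hp₀).eventually_lt (hlim p hpP) h₀).and
    ((hlim p₁ hp₁).eventually_lt (hlim p hpP) h₁)).and
      (Ioc_mem_nhdsGT (zero_lt_one' ℝ)) |>.exists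
  refine ⟨_, hmem p₀ hp₀ t ht, _, hmem p₁ hp₁ t ht, p + t • (o - p), ?_, ht₀, ht₁⟩
  obtain ⟨a, b, ha, hb, hab, rfl⟩ := hp
  refine ⟨a, b, ha, hb, hab, ?_⟩
  obtain rfl := eq_sub_of_add_eq hab
  module

namespace Admissible

variable {x z : E n}

lemma continuousOn_cAffine (h : Admissible X Y c) (hx : x ∈ X) :
    ContinuousOn (fun v : E n × E n => cAffine X Y c x v.2 v.1) (X ×ˢ coordSet X Y c x) := by
  have he : ContinuousOn (fun v : E n × E n => cExp X Y c x v.2) (X ×ˢ coordSet X Y c x) :=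
    (h.continuousOn_cExp hx).comp continuousOn_snd fun v hv => hv.2
  have h1 : ContinuousOn (fun v : E n × E n => c v.1 (cExp X Y c x v.2))
      (X ×ˢ coordSet X Y c x) :=
    h.continuousOn_cost.comp (f := fun v : E n × E n => (v.1, cExp X Y c x v.2))
      (continuousOn_fst.prodMk he) fun v hv => ⟨hv.1, cExp_mem hv.2⟩
  have h2 : ContinuousOn (fun v : E n × E n => c x (cExp X Y c x v.2)) (X ×ˢ coordSet X Y c x) :=
    (h.continuousOn_cost_right hx).comp he fun v hv => cExp_mem hv.2
  exact h1.neg.add h2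

lemma continuousOn_cAffine_slope (h : Admissible X Y c) (hx : x ∈ X) (hz : z ∈ X) :
    ContinuousOn (fun p => cAffine X Y c x p z) (coordSet X Y c x) :=
  (h.continuousOn_cAffine hx).comp (f := fun p => (z, p)) (by fun_prop) fun _ hp => ⟨hz, hp⟩

lemma tendsto_cAffine (h : Admissible X Y c) (hx : x ∈ interior X) {ε : ℝ} (hε : 0 < ε) :
    ∀ᶠ w in 𝓝 x, ∀ p ∈ coordSet X Y c x, |cAffine X Y c x p w| < ε := by
  have hxX := interior_subset hx
  obtain ⟨v, hv, hvK⟩ := (h.isCompact_coordSet hxX).mem_uniformity_of_prod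
    (f := fun w p => cAffine X Y c x p w) (h.continuousOn_cAffine hxX) hxX
    (Metric.dist_mem_uniformity hε)
  rw [nhdsWithin_eq_nhds.2 (mem_interior_iff_mem_nhds.1 hx)] at hv
  filter_upwards [hv] with w hw p hp
  have h1 : dist (cAffine X Y c x p w) (cAffine X Y c x p x) < ε := hvK w hw p hp
  rwa [cAffine_self, Real.dist_eq, sub_zero] at h1

lemma hasFDerivWithinAt_cost_left (h : Admissible X Y c) {w y y' : E n} (hw : w ∈ X) (hy : y ∈ Y)
    (hy' : y' ∈ Y) :
    HasFDerivWithinAt (fun w => -c w y' + c w y)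
      (innerSL ℝ (-gradX X c w y' + gradX X c w y)) X w :=
  h.swap.hasFDerivWithinAt_cost_sub hy hy' hw

/-- If Loeper's property fails, then so does the dual property, that for fixed `x` and `z` the
function `y ↦ -c (z, y) + c (x, y)` is quasiconvex in the dual coordinates at `x`. The failure
can be found at an interior point `x` and strictly inside the domain of the coordinates. -/
lemma exists_dual_violation (h : Admissible X Y c) (hL : ¬ Loeper X Y c) :
    ∃ x ∈ interior X, ∃ z ∈ X, ∃ p₀ ∈ interior (coordSet X Y c x),
      ∃ p₁ ∈ interior (coordSet X Y c x), ∃ p ∈ segment ℝ p₀ p₁,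
        cAffine X Y c x p₀ z < cAffine X Y c x p z ∧
          cAffine X Y c x p₁ z < cAffine X Y c x p z := by
  simp only [Loeper, not_forall, not_le] at hL
  obtain ⟨x₀, hx₀, x₁, hx₁, y₀, hy₀, y, hy, x, ⟨hx, hxs⟩, hlt⟩ := hL
  rw [max_lt_iff] at hlt
  set c' : E n → E n → ℝ := fun y x => c x y with hc'
  set ξ : E n → E n := cExp Y X c' y₀ with hξ
  obtain ⟨q₀, hq₀, q₁, hq₁, q, hq, hlt₀, hlt₁⟩ := exists_violation_interior
    (h.swap.convex_coordSet hy₀) (h.swap.interior_coordSet_nonempty hy₀)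
    (g := fun q => -c (ξ q) y + c (ξ q) y₀)
    (((h.continuousOn_cost_left hy).neg.add (h.continuousOn_cost_left hy₀)).comp
      (h.swap.continuousOn_cExp hy₀) fun q hq => cExp_mem hq)
    (coord_mem (c := c') hx₀) (coord_mem (c := c') hx₁) hxs
    (by
      have h₀ := h.cExp_gradY hx₀ hy₀
      have h₁ := h.cExp_gradY hx hy₀
      simp only [hξ, hc', gradX, gradY] at h₀ h₁ ⊢
      rw [h₀, h₁]
      exact hlt.1)
    (by
      have h₀ := h.cExp_gradY hx₁ hy₀
      have h₁ := h.cExp_gradY hx hy₀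
      simp only [hξ, hc', gradX, gradY] at h₀ h₁ ⊢
      rw [h₀, h₁]
      exact hlt.2)
  clear hlt hxs hx hx₁ hx₀ x x₁ x₀
  have hqi := (h.swap.convex_coordSet hy₀).interior.segment_subset hq₀ hq₁ hq
  have hξi : ξ q ∈ interior X := h.swap.cExp_mem_interior hy₀ hqi
  have hξX : ξ q ∈ X := interior_subset hξi
  have hgrad : -gradY Y c (ξ q) y₀ = q := gradY_cExp (interior_subset hqi)
  by_contra! hcon
  -- without such a violation, the derivatives at `y₀` towards points near `y` are nonpositive
  have hnonpos : ∀ r ∈ interior (coordSet Y X c' y₀),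
      -c (ξ r) y + c (ξ r) y₀ < -c (ξ q) y + c (ξ q) y₀ →
      ∀ᶠ p in 𝓝[coordSet X Y c (ξ q)] (-gradX X c (ξ q) y),
        inner ℝ (r - q) (hessInv X Y c (ξ q) y₀ (p - -gradX X c (ξ q) y₀)) ≤ 0 := by
    intro r hr hlt
    have hrX : ξ r ∈ X := cExp_mem (interior_subset hr)
    have hG := h.continuousOn_cAffine_slope hξX hrX
    have hev : ∀ᶠ p in 𝓝[coordSet X Y c (ξ q)] (-gradX X c (ξ q) y),
        cAffine X Y c (ξ q) p (ξ r) <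
          cAffine X Y c (ξ q) (-gradX X c (ξ q) y₀) (ξ r) := by
      refine (hG _ (coord_mem hy)).eventually (gt_mem_nhds ?_)
      simp only [cAffine, h.cExp_coord hξX hy, h.cExp_coord hξX hy₀]
      linarith
    filter_upwards [hev, self_mem_nhdsWithin] with p hp hpP
    have hP := h.convex_coordSet hξX
    have h1 := hasFDerivWithinAt_nonpos_of_le_segment
      (h.hasFDerivWithinAt_cost_cExp_coord hξX hrX hy₀)
      (hP.segment_subset (coord_mem hy₀) hpP) (fun s hs => by
        by_contra! hgt
        obtain ⟨p₀, hp₀, p₁, hp₁, p', hp', hv₀, hv₁⟩ := exists_violation_interior hP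
          (h.interior_coordSet_nonempty hξX) hG (coord_mem hy₀) hpP hs hgt (hp.trans hgt)
        exact (hcon _ hξi _ hrX p₀ hp₀ p₁ hp₁ p' hp' hv₀).not_gt hv₁)
    have hgr : -gradY Y c (ξ r) y₀ = r := gradY_cExp (interior_subset hr)
    rw [ContinuousLinearMap.comp_apply, innerSL_apply_apply, ← sub_neg_eq_add, hgr, hgrad] at h1
    exact h1
  -- the two derivatives are opposite to each other, so one of them vanishes near `y`
  have hfinal : ∀ r ∈ interior (coordSet Y X c' y₀), ∀ s ∈ interior (coordSet Y X c' y₀),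
      ∀ a b : ℝ, 0 < a → 0 ≤ b → a + b = 1 → a • r + b • s = q →
      -c (ξ r) y + c (ξ r) y₀ < -c (ξ q) y + c (ξ q) y₀ →
      -c (ξ s) y + c (ξ s) y₀ < -c (ξ q) y + c (ξ q) y₀ → False := by
    intro r hr s hs a b ha hb hab hrs hltr hlts
    have hev := (hnonpos r hr hltr).and (hnonpos s hs hlts)
    obtain ⟨U, hU, hUP⟩ := mem_nhdsWithin_iff_exists_mem_nhds_inter.1 hev
    have hzero : hessInv Y X c' y₀ (ξ q) (r - q) = 0 := by
      refine eq_zero_of_inner_eq_zero_near (h.convex_coordSet hξX)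
        (h.interior_coordSet_nonempty hξX) (p₀ := -gradX X c (ξ q) y₀) (coord_mem hy) hU
        fun p hp hpU => ?_
      rw [← h.inner_hessInv hξX hy₀, real_inner_comm]
      obtain ⟨h1, h2⟩ := hUP ⟨hpU, hp⟩
      set N := hessInv X Y c (ξ q) y₀ (p - -gradX X c (ξ q) y₀)
      have h3 : a * inner ℝ (r - q) N + b * inner ℝ (s - q) N = 0 := by
        rw [← real_inner_smul_left, ← real_inner_smul_left, ← inner_add_left]
        have : a • (r - q) + b • (s - q) = 0 := by
          rw [smul_sub, smul_sub, sub_add_sub_comm, hrs, ← add_smul, hab, one_smul, sub_self]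
        rw [this, inner_zero_left]
      refine le_antisymm h1 ?_
      by_contra! hneg
      nlinarith [mul_neg_of_pos_of_neg ha hneg, mul_nonpos_of_nonneg_of_nonpos hb h2]
    have hrq := sub_eq_zero.1
      ((h.swap.hessInv_isInvertible hy₀ hξX).injective (hzero.trans (map_zero _).symm))
    rw [hrq] at hltr
    exact lt_irrefl _ hltr
  obtain ⟨a, b, ha, hb, hab, habq⟩ := hq
  rcases ha.eq_or_lt with rfl | ha
  · exact hfinal q₁ hq₁ q₀ hq₀ b 0 (by linarith) le_rfl (by linarith)
      (by rw [← habq, add_comm]) hlt₁ hlt₀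
  · exact hfinal q₀ hq₀ q₁ hq₁ a b ha hb hab habq hlt₀ hlt₁

/-- Near `x`, from any point in any direction, one of the `c`-affine functions with slope close to
`p₀` or `p₁` grows less than the one whose slope `p` lies between `p₀` and `p₁`. -/
lemma exists_ball_slope (h : Admissible X Y c) (hx : x ∈ interior X) {p₀ p₁ p : E n} {η : ℝ}
    (hη : 0 < η) (hB : closedBall p₀ η ∪ closedBall p₁ η ⊆ coordSet X Y c x)
    (hpP : p ∈ coordSet X Y c x) (hp : p ∈ segment ℝ p₀ p₁) :
    ∃ r > 0, ball x r ⊆ X ∧ ∀ w ∈ ball x r, ∀ w' ∈ ball x r,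
      ∃ q ∈ closedBall p₀ η ∪ closedBall p₁ η,
        cAffine X Y c x q w' - cAffine X Y c x q w ≤
          cAffine X Y c x p w' - cAffine X Y c x p w - η / 2 * ‖w' - w‖ := by
  have hxX := interior_subset hx
  have hy := cExp_mem hpP
  obtain ⟨v, hv, hvK⟩ := h.compactY.mem_uniformity_of_prod
    (f := fun w y => -gradX X c w y + gradX X c w (cExp X Y c x p)) (h.continuousOn_gradX_sub hy)
    hxX (Metric.dist_mem_uniformity (half_pos hη))
  have hXn := mem_interior_iff_mem_nhds.1 hx
  rw [nhdsWithin_eq_nhds.2 hXn] at hv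
  obtain ⟨r, hr, hrv⟩ := Metric.mem_nhds_iff.1 (inter_mem hv hXn)
  have hrX : ball x r ⊆ X := fun w hw => (hrv hw).2
  refine ⟨r, hr, hrX, fun w hw w' hw' => ?_⟩
  obtain ⟨q, hq, hqd⟩ : ∃ q ∈ closedBall p₀ η ∪ closedBall p₁ η,
      inner ℝ (q - p) (w' - w) ≤ -η * ‖w' - w‖ := by
    set d := w' - w
    set e := (η / ‖d‖) • d with he
    have hen : ‖e‖ ≤ η := by
      rw [he, norm_smul, norm_div, norm_norm, Real.norm_of_nonneg hη.le]
      rcases eq_or_ne ‖d‖ 0 with h0 | h0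
      · simpa [h0] using hη.le
      · rw [div_mul_cancel₀ _ h0]
    have hed : inner ℝ e d = η * ‖d‖ := by
      rw [he, real_inner_smul_left, real_inner_self_eq_norm_sq]
      rcases eq_or_ne ‖d‖ 0 with h0 | h0
      · simp [h0]
      · field_simp
    have hstep : ∀ s, inner ℝ (s - p) d ≤ 0 → inner ℝ (s - e - p) d ≤ -η * ‖d‖ := fun s hs => by
      rw [sub_right_comm, inner_sub_left, hed]
      linarith
    have hmem : ∀ s, s - e ∈ closedBall s η := fun s => by
      rwa [mem_closedBall, dist_eq_norm, sub_sub_cancel_left, norm_neg]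
    obtain ⟨a, b, ha, hb, hab, habp⟩ := hp
    have hsum : a * inner ℝ (p₀ - p) d + b * inner ℝ (p₁ - p) d = 0 := by
      rw [← real_inner_smul_left, ← real_inner_smul_left, ← inner_add_left]
      have : a • (p₀ - p) + b • (p₁ - p) = 0 := by
        rw [smul_sub, smul_sub, sub_add_sub_comm, habp, ← add_smul, hab, one_smul, sub_self]
      rw [this, inner_zero_left]
    rcases le_or_gt (inner ℝ (p₀ - p) d) 0 with h0 | h0
    · exact ⟨p₀ - e, Or.inl (hmem p₀), hstep p₀ h0⟩
    rcases le_or_gt (inner ℝ (p₁ - p) d) 0 with h1 | h1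
    · exact ⟨p₁ - e, Or.inr (hmem p₁), hstep p₁ h1⟩
    exfalso
    rcases ha.eq_or_lt with rfl | ha
    · obtain rfl : b = 1 := by linarith
      linarith
    · nlinarith [mul_pos ha h0, mul_nonneg hb h1.le]
  refine ⟨q, hq, ?_⟩
  have hqP := hB hq
  have hqY := cExp_mem hqP
  have h1 := (convex_ball x r).norm_image_sub_le_of_norm_hasFDerivWithin_le'
    (f := fun w => -c w (cExp X Y c x q) + c w (cExp X Y c x p))
    (φ := innerSL ℝ (q - p)) (C := η / 2)
    (fun w hw => (h.hasFDerivWithinAt_cost_left (hrX hw) hy hqY).mono hrX)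
    (fun w hw => by
      have h2 : dist (-gradX X c w (cExp X Y c x q) + gradX X c w (cExp X Y c x p))
          (-gradX X c x (cExp X Y c x q) + gradX X c x (cExp X Y c x p)) < η / 2 :=
        hvK w (hrv hw).1 _ hqY
      have h3 : -gradX X c x (cExp X Y c x q) + gradX X c x (cExp X Y c x p) = q - p := by
        rw [← sub_neg_eq_add, coord_cExp hqP, coord_cExp hpP]
      rw [h3, dist_eq_norm] at h2
      rw [← map_sub, innerSL_apply_norm]
      exact h2.le) hw hw'
  have h2 := (abs_le.1 h1).2
  rw [innerSL_apply_apply] at h2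
  simp only [cAffine]
  linarith

/-- Away from `x`, the `c`-affine functions with slopes in the interior of a set `B` lie strictly
and uniformly below the supremum over `B`, because their derivative with respect to the slope does
not vanish. -/
lemma exists_gap (h : Admissible X Y c) (hx : x ∈ X) {B B' : Set (E n)} {ψ : E n → ℝ} {r : ℝ}
    (hr : 0 < r) (hB : B ⊆ coordSet X Y c x) (hB' : IsCompact B') (hBB : B' ⊆ interior B)
    (hψ : ∀ w ∈ X, ∃ q ∈ B, ψ w = cAffine X Y c x q w)
    (hψB : ∀ w ∈ X, ∀ q ∈ B, cAffine X Y c x q w ≤ ψ w) :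
    ∃ κ > 0, ∀ w ∈ X \ ball x r, ∀ q ∈ B', cAffine X Y c x q w + κ ≤ ψ w := by
  have hcomp : IsCompact ((X \ ball x r) ×ˢ B') := (h.compactX.diff isOpen_ball).prod hB'
  rcases ((X \ ball x r) ×ˢ B').eq_empty_or_nonempty with hempty | hne
  · exact ⟨1, one_pos, fun w hw q hq => absurd (mk_mem_prod hw hq) (by simp [hempty])⟩
  have hBP : B' ⊆ coordSet X Y c x := hBB.trans (interior_subset.trans hB)
  have hsub : (X \ ball x r) ×ˢ B' ⊆ X ×ˢ coordSet X Y c x := prod_mono sdiff_subset hBP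
  have hlsc : LowerSemicontinuousOn (fun v : E n × E n => ψ v.1 - cAffine X Y c x v.2 v.1)
      ((X \ ball x r) ×ˢ B') := by
    intro v hv t ht
    obtain ⟨s, hs, hψs⟩ := hψ v.1 hv.1.1
    have h1 : ContinuousOn
        (fun v : E n × E n => cAffine X Y c x s v.1 - cAffine X Y c x v.2 v.1)
        ((X \ ball x r) ×ˢ B') :=
      ((h.continuousOn_cAffine hx).comp (f := fun v : E n × E n => (v.1, s)) (by fun_prop)
        fun v hv => ⟨hv.1.1, hB hs⟩).sub ((h.continuousOn_cAffine hx).mono hsub)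
    have ht' : t < cAffine X Y c x s v.1 - cAffine X Y c x v.2 v.1 := hψs ▸ ht
    filter_upwards [(h1 v hv).eventually (lt_mem_nhds ht'), self_mem_nhdsWithin] with v' h2 hv'
    exact h2.trans_le (sub_le_sub_right (hψB v'.1 hv'.1.1 s hs) _)
  obtain ⟨⟨w₀, q₀⟩, ⟨hw₀, hq₀⟩, hmin⟩ := LowerSemicontinuousOn.exists_isMinOn hne hcomp hlsc
  simp only at hw₀ hq₀
  refine ⟨ψ w₀ - cAffine X Y c x q₀ w₀, ?_, fun w hw q hq => ?_⟩
  · by_contra! hle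
    have hBn : B ∈ 𝓝 q₀ := mem_interior_iff_mem_nhds.1 (hBB hq₀)
    have hmax : IsLocalMax
        (fun q => -c w₀ (cExp X Y c x q) + c x (cExp X Y c x q)) q₀ := by
      filter_upwards [hBn] with q hq
      have h1 := hψB w₀ hw₀.1 q hq
      simp only [cAffine] at h1 hle ⊢
      linarith
    have hder := hmax.hasFDerivAt_eq_zero ((h.hasFDerivWithinAt_cost_cExp hx hw₀.1
      (hBP hq₀)).hasFDerivAt (mem_of_superset hBn hB))
    have hy := cExp_mem (hBP hq₀)
    have hgrad : -gradY Y c w₀ (cExp X Y c x q₀) + gradY Y c x (cExp X Y c x q₀) = 0 := by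
      obtain ⟨u, hu⟩ := (h.hessInv_isInvertible hx hy).surjective
        (-gradY Y c w₀ (cExp X Y c x q₀) + gradY Y c x (cExp X Y c x q₀))
      have h1 := DFunLike.congr_fun hder u
      rw [ContinuousLinearMap.comp_apply, innerSL_apply_apply, hu] at h1
      exact inner_self_eq_zero.1 h1
    have hw₀x : w₀ = x := h.twisted.2 _ hy hw₀.1 hx (by
      simpa [add_eq_zero_iff_eq_neg] using hgrad)
    exact hw₀.2 (hw₀x ▸ mem_ball_self hr)
  · have h1 : ψ w₀ - cAffine X Y c x q₀ w₀ ≤ ψ w - cAffine X Y c x q w :=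
      isMinOn_iff.1 hmin (w, q) ⟨hw, hq⟩
    linarith

/-- From a dual violation: the supremum `ψ` of the `c`-affine functions with slopes near `p₀` and
`p₁`, raised near `x` to a `c`-affine function with the intermediate slope `p`, is alternative
`c`-convex. It has no global support at `x`, where its only possible slope is `p`. -/
lemma exists_isAltCConvex_not_isCConvex (h : Admissible X Y c) (hx : x ∈ interior X) (hz : z ∈ X)
    {p₀ p₁ p : E n} (hp₀ : p₀ ∈ interior (coordSet X Y c x))
    (hp₁ : p₁ ∈ interior (coordSet X Y c x)) (hp : p ∈ segment ℝ p₀ p₁)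
    (h₀ : cAffine X Y c x p₀ z < cAffine X Y c x p z)
    (h₁ : cAffine X Y c x p₁ z < cAffine X Y c x p z) :
    ∃ φ : X → ℝ, IsAltCConvex X Y c φ ∧ ¬ IsCConvex X Y c φ := by
  have hxX := interior_subset hx
  set P := coordSet X Y c x with hP
  set F := cAffine X Y c x with hF
  have hFx : ∀ q, F q x = 0 := cAffine_self x
  have hpP : p ∈ P :=
    (h.convex_coordSet hxX).segment_subset (interior_subset hp₀) (interior_subset hp₁) hp
  -- closed balls of radius `2 η` around `p₀` and `p₁` on which the violation persists
  have hnear : ∀ q ∈ interior P, F q z < F p z → ∃ ε > 0, ball q ε ⊆ {s ∈ P | F s z < F p z} :=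
    fun q hq hlt => Metric.mem_nhds_iff.1 <| by
      have hPn := mem_interior_iff_mem_nhds.1 hq
      filter_upwards [hPn, ((h.continuousOn_cAffine_slope hxX hz).continuousAt hPn).eventually
        (gt_mem_nhds hlt)] with s hs hs'
      exact ⟨hs, hs'⟩
  obtain ⟨ε₀, hε₀, hball₀⟩ := hnear p₀ hp₀ h₀
  obtain ⟨ε₁, hε₁, hball₁⟩ := hnear p₁ hp₁ h₁
  obtain ⟨η, hη, hηlt⟩ : ∃ η > 0, 2 * η < min ε₀ ε₁ :=
    ⟨min ε₀ ε₁ / 3, by positivity, by linarith [lt_min hε₀ hε₁]⟩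
  set B := closedBall p₀ (2 * η) ∪ closedBall p₁ (2 * η) with hBdef
  set B' := closedBall p₀ η ∪ closedBall p₁ η with hBdef'
  have hBprop : ∀ q ∈ B, q ∈ P ∧ F q z < F p z := by
    rintro q (hq | hq)
    · exact hball₀ (closedBall_subset_ball (hηlt.trans_le (min_le_left _ _)) hq)
    · exact hball₁ (closedBall_subset_ball (hηlt.trans_le (min_le_right _ _)) hq)
  have hBP : B ⊆ P := fun q hq => (hBprop q hq).1
  have hBc : IsCompact B := (isCompact_closedBall _ _).union (isCompact_closedBall _ _)
  have hBc' : IsCompact B' := (isCompact_closedBall _ _).union (isCompact_closedBall _ _)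
  have hη2 : η < 2 * η := by linarith
  have hBB : B' ⊆ interior B :=
    (union_subset_union (closedBall_subset_ball hη2) (closedBall_subset_ball hη2)).trans
      (interior_maximal (union_subset_union ball_subset_closedBall ball_subset_closedBall)
        (isOpen_ball.union isOpen_ball))
  have hBP' : B' ⊆ P := hBB.trans (interior_subset.trans hBP)
  have hp₀B : p₀ ∈ B' := Or.inl (mem_closedBall_self hη.le)
  -- the supremum `ψ` of the `c`-affine functions with slopes in `B`
  have hsup : ∀ w, ∃ q ∈ B, w ∈ X → IsMaxOn (fun q => F q w) B q := fun w => by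
    by_cases hw : w ∈ X
    · obtain ⟨q, hq, hqm⟩ := hBc.exists_isMaxOn ⟨p₀, interior_subset (hBB hp₀B)⟩
        ((h.continuousOn_cAffine_slope hxX hw).mono hBP)
      exact ⟨q, hq, fun _ => hqm⟩
    · exact ⟨p₀, interior_subset (hBB hp₀B), fun hw' => absurd hw' hw⟩
  choose b hbB hbmax using hsup
  set ψ : E n → ℝ := fun w => F (b w) w with hψ
  have hψB : ∀ w ∈ X, ∀ q ∈ B, F q w ≤ ψ w := fun w hw q hq => hbmax w hw hq
  -- `r`, `κ` and `δ` are chosen in this order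
  obtain ⟨r', hr', hr'X, hslope'⟩ := h.exists_ball_slope hx hη hBP' hpP hp
  have hzx : z ≠ x := by
    rintro rfl
    simp [hFx] at h₀
  set r := min r' (dist z x) with hrdef
  have hr : 0 < r := lt_min hr' (dist_pos.2 hzx)
  have hrr : ball x r ⊆ ball x r' := ball_subset_ball (min_le_left _ _)
  have hrX : ball x r ⊆ X := hrr.trans hr'X
  have hzr : z ∉ ball x r := fun hz' => (mem_ball.1 hz').not_ge (min_le_right _ _)
  obtain ⟨κ, hκ, hgap⟩ := h.exists_gap hxX hr hBP hBc' hBB (fun w _ => ⟨b w, hbB w, rfl⟩) hψB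
  obtain ⟨r₁, hr₁, hr₁κ⟩ := Metric.eventually_nhds_iff_ball.1
    (h.tendsto_cAffine hx (show 0 < κ / 4 by linarith))
  obtain ⟨δ, hδ, hδκ, hδr⟩ : ∃ δ > 0, δ ≤ κ / 2 ∧ δ ≤ η / 2 * r₁ :=
    ⟨min (κ / 2) (η / 2 * r₁), by positivity, min_le_left _ _, min_le_right _ _⟩
  -- where `ψ` is raised, it is raised by little
  have hraise : ∀ w ∈ ball x r, ψ w < F p w + δ → ∀ q ∈ B', F p w + δ ≤ F q w + κ := by
    intro w hw hlt q hq
    obtain ⟨s, hs, hsw⟩ := hslope' w (hrr hw) x (mem_ball_self hr')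
    have h2 : cAffine X Y c x s w ≤ ψ w := hψB w (hrX hw) s (interior_subset (hBB hs))
    rw [cAffine_self, cAffine_self, norm_sub_rev, ← dist_eq_norm] at hsw
    have h3 : dist w x < r₁ := by
      have h4 : η / 2 * dist w x < η / 2 * r₁ := by
        change _ ≤ 0 - F p w - _ at hsw
        linarith
      exact lt_of_mul_lt_mul_left h4 (by positivity)
    have h5 := (abs_lt.1 (hr₁κ w h3 p hpP)).2
    have h6 := (abs_lt.1 (hr₁κ w h3 q (hBP' hq))).1
    change F p w < _ at h5
    change _ < F q w at h6
    linarith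
  classical
  set f : E n → ℝ := fun w => if w ∈ ball x r then max (ψ w) (F p w + δ) else ψ w with hf
  have hψf : ∀ w, ψ w ≤ f w := fun w => by
    simp only [hf]
    split_ifs
    · exact le_max_left _ _
    · exact le_rfl
  have hFf : ∀ w ∈ ball x r, F p w + δ ≤ f w := fun w hw => by
    simp only [hf, if_pos hw]
    exact le_max_right _ _
  have hYn := h.interiorY.mono interior_subset
  refine ⟨fun w => f w, ?_, ?_⟩
  · rw [isAltCConvex_iff h.compactY hYn fun x hx => h.continuousOn_cost_right hx]
    rintro ⟨w₀, hw₀⟩ ⟨w₁, hw₁⟩ ⟨w, hw⟩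
    suffices hs : ∃ q ∈ P, f w - F q w ≤ f w₀ - F q w₀ ∧ f w - F q w ≤ f w₁ - F q w₁ by
      obtain ⟨q, hq, hq₀, hq₁⟩ := hs
      simp only [hF, cAffine] at hq₀ hq₁
      exact ⟨_, cExp_mem hq, by linarith, by linarith⟩
    by_cases hraised : w ∈ ball x r ∧ ψ w < F p w + δ
    · obtain ⟨hwr, hlt⟩ := hraised
      have hfw : f w = F p w + δ := by simp only [hf, if_pos hwr, max_eq_right hlt.le]
      have hfar : ∀ q ∈ B', ∀ v ∈ X, v ∉ ball x r → f w - F q w ≤ f v - F q v := by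
        intro q hq v hv hvr
        have h2 : F q v + κ ≤ ψ v := hgap v ⟨hv, hvr⟩ q hq
        linarith [hψf v, hraise w hwr hlt q hq]
      have hclose : ∀ v ∈ ball x r, ∃ q ∈ B', f w - F q w ≤ f v - F q v := by
        intro v hv
        obtain ⟨q, hq, hqv⟩ := hslope' w (hrr hwr) v (hrr hv)
        have h2 : 0 ≤ η / 2 * ‖v - w‖ := by positivity
        change F q v - F q w ≤ F p v - F p w - _ at hqv
        exact ⟨q, hq, by linarith [hFf v hv]⟩
      by_cases hw₀r : w₀ ∈ ball x r <;> by_cases hw₁r : w₁ ∈ ball x r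
      · exact ⟨p, hpP, by linarith [hFf w₀ hw₀r], by linarith [hFf w₁ hw₁r]⟩
      · obtain ⟨q, hq, hqv⟩ := hclose w₀ hw₀r
        exact ⟨q, hBP' hq, hqv, hfar q hq w₁ hw₁ hw₁r⟩
      · obtain ⟨q, hq, hqv⟩ := hclose w₁ hw₁r
        exact ⟨q, hBP' hq, hfar q hq w₀ hw₀ hw₀r, hqv⟩
      · exact ⟨p₀, hBP' hp₀B, hfar p₀ hp₀B w₀ hw₀ hw₀r, hfar p₀ hp₀B w₁ hw₁ hw₁r⟩
    · have hfw : f w = ψ w := by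
        simp only [hf]
        split_ifs with hwr
        · exact max_eq_left (not_lt.1 fun hlt => hraised ⟨hwr, hlt⟩)
        · rfl
      have hsupp : ∀ v ∈ X, f w - F (b w) w ≤ f v - F (b w) v := fun v hv => by
        have h2 : ψ w = F (b w) w := rfl
        linarith [hψf v, hψB v hv (b w) (hbB w)]
      exact ⟨b w, hBP (hbB w), hsupp w₀ hw₀, hsupp w₁ hw₁⟩
  · rw [isCConvex_iff h.compactY ⟨x, hxX⟩ fun x hx => h.continuousOn_cost_right hx]
    intro hcon
    obtain ⟨y, hy, hsupp⟩ := hcon ⟨x, hxX⟩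
    simp only at hsupp
    have hfx : f x = δ := by
      simp only [hf, hψ, if_pos (mem_ball_self hr), hFx, zero_add, max_eq_right hδ.le]
    -- near `x` the function is `c`-affine of slope `p`, which determines `y`
    have hfnear : ∀ᶠ w in 𝓝 x, f w = F p w + δ := by
      filter_upwards [ball_mem_nhds x hr, h.tendsto_cAffine hx (half_pos hδ)] with w hw hwδ
      have h2 := (abs_lt.1 (hwδ (b w) (hBP (hbB w)))).2
      have h3 := (abs_lt.1 (hwδ p hpP)).1
      simp only [hf, hψ, if_pos hw]
      refine max_eq_right ?_
      change F (b w) w < _ at h2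
      change _ < F p w at h3
      linarith
    have hmin : IsLocalMin (fun w => -c w (cExp X Y c x p) + c w y) x := by
      filter_upwards [hfnear, mem_interior_iff_mem_nhds.1 hx] with w hw hwX
      have h2 := hsupp ⟨w, hwX⟩
      simp only [hfx, hw, hF, cAffine] at h2
      linarith
    have hyp : y = cExp X Y c x p := by
      have hder := hmin.hasFDerivAt_eq_zero ((h.hasFDerivWithinAt_cost_left hxX hy
        (cExp_mem hpP)).hasFDerivAt (mem_interior_iff_mem_nhds.1 hx))
      have h2 : -gradX X c x (cExp X Y c x p) + gradX X c x y = 0 := by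
        have h3 := DFunLike.congr_fun hder (-gradX X c x (cExp X Y c x p) + gradX X c x y)
        rw [innerSL_apply_apply] at h3
        exact inner_self_eq_zero.1 h3
      refine (h.twisted.1 x hxX (cExp_mem hpP) hy ?_).symm
      simpa [add_eq_zero_iff_eq_neg] using h2
    have h2 := hsupp ⟨z, hz⟩
    have h3 : f z = F (b z) z := by simp only [hf, hψ, if_neg hzr]
    have h4 := (hBprop (b z) (hbB z)).2
    simp only [hfx, hyp] at h2
    rw [h3] at h2
    have h5 : F p z = -c z (cExp X Y c x p) + c x (cExp X Y c x p) := rfl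
    linarith

end Admissible

end OTCost

theorem theorem1p1 (n : ℕ) (X Y : Set (OTCost.E n)) (c : OTCost.E n → OTCost.E n → ℝ)
    (hX : IsCompact X) (hXi : (interior X).Nonempty)
    (hY : IsCompact Y) (hYi : (interior Y).Nonempty)
    (hc : OTCost.IsC2 X Y c) (htw : OTCost.BiTwisted X Y c)
    (hnd : OTCost.NonDegenerate X Y c)
    (hXc : OTCost.CConvexSetX Y c X) (hYc : OTCost.CConvexSetY X c Y) :
    (OTCost.Loeper X Y c →
      ∀ φ : X → ℝ, OTCost.IsCConvex X Y c φ ↔ OTCost.IsAltCConvex X Y c φ) ∧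
    (¬ OTCost.Loeper X Y c →
      ∃ φ : X → ℝ, OTCost.IsAltCConvex X Y c φ ∧ ¬ OTCost.IsCConvex X Y c φ) := by
  have h : OTCost.Admissible X Y c := ⟨hX, hY, hXi, hYi, hc, htw, hnd, hXc, hYc⟩
  refine ⟨fun hL φ => ⟨fun hφ => ?_, hL.isCConvex h⟩, fun hL => ?_⟩
  · exact hφ.isAltCConvex hY (hXi.mono interior_subset) (hYi.mono interior_subset)
      fun x hx => h.continuousOn_cost_right hx
  · obtain ⟨x, hx, z, hz, p₀, hp₀, p₁, hp₁, p, hp, h₀, h₁⟩ := h.exists_dual_violation hL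
    exact h.exists_isAltCConvex_not_isCConvex hx hz hp₀ hp₁ hp h₀ h₁
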